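/- Let $\Omega\subset\mathbb R^2$ be a bounded connected open set with Lipschitz boundary, $I\subset\mathbb R$ a non-degenerate interval, and let $\partial\Omega$ be partitioned into measurable parts $\Gamma_N,\Gamma_D,\Gamma_R,\Gamma_\sharp$, where $\Gamma_\sharp$ is the union of finitely many sets $A_k$ and of their translates $A_k+v_k$. Let $c,\sigma\in L^\infty(\Omega)$ be bounded below by positive constants, $a\in L^\infty(\Gamma_R)$ with $a>0$, and $h\in L^\infty(\Omega)\cap H^1(\Omega)$. Let $\mu$ (a constant, or a function on $\Omega$) be such that $f:=\mu|\nabla h|^2\in L^2(\Omega)$. Here $\nabla$ and $\operatorname{div}$ act in the variables of $\Omega$. Consider the Graetz equation with viscosity $$c\,\partial_{zz}T+\operatorname{div}(\sigma\nabla T)-h\,\partial_zT=\mu|\nabla h|^2\quad\text{on }\Omega\times I\qquad(1)$$ and the Graetz equation without viscosity $$c\,\partial_{zz}T+\operatorname{div}(\sigma\nabla T)-h\,\partial_zT=0\quad\text{on }\Omega\times I,\qquad(2)$$ both with the lateral boundary conditions $\sigma\nabla T\cdot n=0$ on $\Gamma_N$, $T=0$ on $\Gamma_D$, $\sigma\nabla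 T\cdot n+aT=0$ on $\Gamma_R$, and periodicity on $\Gamma_\sharp$ ($T(x+v_k)=T(x)$ for $x\in A_k$, with the corresponding natural condition on the flux). Solutions are functions $T\in C^1(I,L^2(\Omega))\cap C^0(I,H^1(\Omega))$ that satisfy the equation and the boundary conditions in the weak sense in $\Omega$: with $V$ the space of $s\in H^1(\Omega)$ that vanish on $\Gamma_D$ and are periodic on $\Gamma_\sharp$ (in the sense of traces), $T(z)\in V$ for all $z\in I$ and, for all $v\in V$ and $z\in I$ (with $f$ replaced by $0$ for (2)), $$\frac{d}{dz}\int_\Omega c\,\partial_zT\,v=\int_\Omega\sigma\nabla T\cdot\nabla v+\int_{\Gamma_R}aTv+\int_\Omega h\,\partial_zT\,v+\int_\Omega fv .$$ For $g\in L^2(\Omega)$ write $u=\Delta_\sigma^{-1}g$ if $u\in V$ and $\int_\Omega\sigma\nabla u\cdot\nabla v+\int_{\Gamma_R}auv=-\int_\Omega gv$ for all $v\in V$, i.e. $\operatorname{div}(\sigma\nabla u)=g$ with the lateral boundary conditions. The constants are said to be controlled if $\Gamma_D\cup\Gamma_R\neq\emptyset$ (up to sets of length zero). In each of the following cases the function $\widetilde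 T$ is well defined and is a solution of (1), and a function $T$ is a solution of (1) if and only if $T-\widetilde T$ is a solution of (2); thus the problem with viscosity reduces to the problem without viscosity. a) If the constants are controlled, there is exactly one $\Delta_\sigma^{-1}(\mu|\nabla h|^2)$, and $$\widetilde T=\Delta_\sigma^{-1}(\mu|\nabla h|^2).$$ b) If the constants are not controlled and $\int_\Omega h\neq0$ (non-balanced case), there is exactly one $\alpha\in\mathbb R$ with $\int_\Omega(\mu|\nabla h|^2+\alpha h)=0$; for it, $\Delta_\sigma^{-1}(\mu|\nabla h|^2+\alpha h)$ exists and is unique up to an additive constant, and, for any choice of this constant, $$\widetilde T=\alpha z+\Delta_\sigma^{-1}(\mu|\nabla h|^2+\alpha h).$$ c) If the constants are not controlled and $\int_\Omega h=0$ (balanced case), $w=\Delta_\sigma^{-1}h$ exists and is unique up to an additive constant; for any choice of $w$, $$\int_\Omega(c-hw)=\int_\Omega c+\int_\Omega\sigma|\nabla w|^2>0,$$ so that there is exactly one $\alpha\in\mathbb R$ with $\alpha\int_\Omega(c-hw)=\int_\Omega\mu|\nabla h|^2$. The function $\gamma=\mu|\nabla h|^2-\alpha(c-hw)$ belongs to $L^2(\Omega)$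 and has zero average, $\Delta_\sigma^{-1}\gamma$ exists and is unique up to an additive constant, and, for any choice of this constant, $$\widetilde T=\alpha\Big(\frac{z^2}{2}+z\,w\Big)+\Delta_\sigma^{-1}\gamma .$$ -/

import Mathlib

open MeasureTheory Filter Topology
open scoped ENNReal NNReal ContDiff

noncomputable section

namespace Graetz

/-- The plane with its Euclidean norm; it contains the cross section of the pipe. -/
abbrev Plane : Type := EuclideanSpace ℝ (Fin 2)

/-- Lipschitz boundary: near each boundary point, in suitable rotated coordinates, `Ω` is the set of
points strictly below the graph of a Lipschitz function. -/
def HasLipschitzBoundary (Ω : Set Plane) : Prop :=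
  ∀ p ∈ frontier Ω, ∃ (e : Plane ≃ₗᵢ[ℝ] Plane) (K : ℝ≥0) (φ : ℝ → ℝ) (r : ℝ),
    LipschitzWith K φ ∧ 0 < r ∧ ∀ x ∈ Metric.ball p r, (x ∈ Ω ↔ (e x) 1 < φ ((e x) 0))

/-- `u ∈ H¹(Ω)` with weak gradient `G`. -/
structure IsWeakGradient (Ω : Set Plane) (u : Plane → ℝ) (G : Plane → Plane) : Prop where
  memLp : MemLp u 2 (volume.restrict Ω)
  memLp_grad : MemLp G 2 (volume.restrict Ω)
  integral_eq : ∀ φ : Plane → ℝ, ContDiff ℝ ∞ φ → HasCompactSupport φ → tsupport φ ⊆ Ω →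
    ∀ e : Plane, ∫ x in Ω, u x * fderiv ℝ φ x e = - ∫ x in Ω, inner ℝ (G x) e * φ x

/-- The arc-length measure on `∂Ω`. -/
abbrev bdryMeasure (Ω : Set Plane) : Measure Plane := (μH[1]).restrict (frontier Ω)

/-- `g` is the boundary trace of the `H¹(Ω)` function `u` with gradient `G`: some functions smooth
up to the boundary converge to `u` in `H¹(Ω)` and their boundary values converge to `g` in
`L²(∂Ω)`. -/
def HasTrace (Ω : Set Plane) (u : Plane → ℝ) (G : Plane → Plane) (g : Plane → ℝ) : Prop :=
  ∃ φ : ℕ → Plane → ℝ, (∀ n, ContDiff ℝ ∞ (φ n)) ∧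
    Tendsto (fun n => eLpNorm (fun x => φ n x - u x) 2 (volume.restrict Ω)) atTop (𝓝 0) ∧
    Tendsto (fun n => eLpNorm (fun x => gradient (φ n) x - G x) 2 (volume.restrict Ω))
      atTop (𝓝 0) ∧
    Tendsto (fun n => eLpNorm (fun x => φ n x - g x) 2 (bdryMeasure Ω)) atTop (𝓝 0)

/-- The data of the Graetz problem: the cross section, the parts of its boundary, the coefficients.
Periodicity identifies each point `x` of `perPart k` with the point `perShift k + x`. -/
structure Setting where
  Ω : Set Plane
  isOpen : IsOpen Ω
  isConnected : IsConnected Ω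
  isBounded : Bornology.IsBounded Ω
  lipschitz : HasLipschitzBoundary Ω
  ΓN : Set Plane
  ΓD : Set Plane
  ΓR : Set Plane
  Γper : Set Plane
  measurable_ΓN : MeasurableSet ΓN
  measurable_ΓD : MeasurableSet ΓD
  measurable_ΓR : MeasurableSet ΓR
  cover : ΓN ∪ ΓD ∪ ΓR ∪ Γper = frontier Ω
  disjoint_ND : Disjoint ΓN ΓD
  disjoint_NR : Disjoint ΓN ΓR
  disjoint_NP : Disjoint ΓN Γper
  disjoint_DR : Disjoint ΓD ΓR
  disjoint_DP : Disjoint ΓD Γper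
  disjoint_RP : Disjoint ΓR Γper
  numPer : ℕ
  perPart : Fin numPer → Set Plane
  perShift : Fin numPer → Plane
  measurable_perPart : ∀ k, MeasurableSet (perPart k)
  Γper_eq : Γper = ⋃ k, (perPart k ∪ (fun x => perShift k + x) '' perPart k)
  /-- longitudinal diffusion coefficient -/
  c : Plane → ℝ
  /-- transverse diffusion coefficient -/
  σ : Plane → ℝ
  /-- velocity profile -/
  h : Plane → ℝ
  /-- Robin coefficient -/
  a : Plane → ℝ
  c_bdd : MemLp c ∞ (volume.restrict Ω)
  c_pos : ∃ m : ℝ, 0 < m ∧ ∀ᵐ x ∂(volume.restrict Ω), m ≤ c x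
  σ_bdd : MemLp σ ∞ (volume.restrict Ω)
  σ_pos : ∃ m : ℝ, 0 < m ∧ ∀ᵐ x ∂(volume.restrict Ω), m ≤ σ x
  h_bdd : MemLp h ∞ (volume.restrict Ω)
  a_bdd : MemLp a ∞ ((μH[1]).restrict ΓR)
  a_pos : ∀ᵐ x ∂((μH[1]).restrict ΓR), 0 < a x

namespace Setting

variable (D : Setting)

instance : IsFiniteMeasure (volume.restrict D.Ω) :=
  ⟨by simpa using D.isBounded.measure_lt_top⟩

/-- `L²(Ω)` -/
abbrev L2 : Type := Lp ℝ 2 (volume.restrict D.Ω)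

/-- `L²(Ω; ℝ²)` -/
abbrev L2vec : Type := Lp Plane 2 (volume.restrict D.Ω)

/-- `L²(∂Ω)` -/
abbrev L2bdry : Type := Lp ℝ 2 (bdryMeasure D.Ω)

/-- The constant function `r` as an element of `L²(Ω)`. -/
def const (r : ℝ) : D.L2 := Lp.const 2 (volume.restrict D.Ω) r

/-- `s` is an `H¹(Ω)` function, with gradient `G` and trace `g`, which vanishes on `ΓD` and is
periodic on `Γper`. -/
structure Admissible (s : D.L2) (G : D.L2vec) (g : D.L2bdry) : Prop where
  grad : IsWeakGradient D.Ω s G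
  trace : HasTrace D.Ω s G g
  dirichlet : ∀ᵐ x ∂((μH[1]).restrict D.ΓD), g x = 0
  periodic : ∀ k, ∀ᵐ x ∂((μH[1]).restrict (D.perPart k)), g (D.perShift k + x) = g x

/-- `∫_Ω σ ∇s·∇s' + ∫_{ΓR} a s s'`: the weak form of `-div (σ ∇ ·)` together with the Neumann
condition on `ΓN`, the Robin condition on `ΓR` and the periodicity of the flux on `Γper`. -/
def form (G : D.L2vec) (g : D.L2bdry) (G' : D.L2vec) (g' : D.L2bdry) : ℝ :=
  (∫ x in D.Ω, D.σ x * inner ℝ (G x) (G' x)) + ∫ x in D.ΓR, D.a x * g x * g' x ∂μH[1]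

/-- `u` is (a representative of) `Δ_σ⁻¹ f`: `div (σ ∇u) = f` with the lateral boundary conditions,
in the weak sense. -/
def IsInvLaplacian (f : Plane → ℝ) (u : D.L2) : Prop :=
  ∃ (G : D.L2vec) (g : D.L2bdry), D.Admissible u G g ∧
    ∀ (v : D.L2) (Gv : D.L2vec) (gv : D.L2bdry), D.Admissible v Gv gv →
      D.form G g Gv gv = - ∫ x in D.Ω, f x * v x

/-- `Δ_σ⁻¹ f` exists and is a single class modulo the constants. -/
def InvLaplacianModConst (f : Plane → ℝ) : Prop :=
  ∃ u : D.L2, ∀ u' : D.L2, D.IsInvLaplacian f u' ↔ ∃ k : ℝ, u' = u + D.const k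

/-- The constants are controlled: `ΓD ∪ ΓR` is non-empty (up to sets of length zero, which the
boundary conditions do not see). -/
def ConstantsControlled : Prop := μH[1] (D.ΓD ∪ D.ΓR) ≠ 0

/-- `T ∈ C¹(I, L²(Ω)) ∩ C⁰(I, H¹(Ω))` solves `c ∂_zz T + div (σ ∇T) - h ∂_z T = f` on `Ω × I` with
the lateral boundary conditions, weakly in the cross section. Here `T'`, `G`, `g` are `∂_z T`, the
transverse gradient and the lateral trace. -/
def IsSolution (I : Set ℝ) (f : Plane → ℝ) (T : ℝ → D.L2) : Prop :=
  ∃ (T' : ℝ → D.L2) (G : ℝ → D.L2vec) (g : ℝ → D.L2bdry),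
    (∀ z ∈ I, HasDerivWithinAt T (T' z) I z) ∧ ContinuousOn T' I ∧ ContinuousOn G I ∧
    (∀ z ∈ I, D.Admissible (T z) (G z) (g z)) ∧
    ∀ (v : D.L2) (Gv : D.L2vec) (gv : D.L2bdry), D.Admissible v Gv gv → ∀ z ∈ I,
      HasDerivWithinAt (fun t => ∫ x in D.Ω, D.c x * T' t x * v x)
        (D.form (G z) (g z) Gv gv + (∫ x in D.Ω, D.h x * T' z x * v x) + ∫ x in D.Ω, f x * v x)
        I z

/-- `S` is a particular solution for the source `f`, and the change of unknown `T ↦ T - S` turns the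
problem with source `f` into the problem without source, and conversely. -/
def Reduces (I : Set ℝ) (f : Plane → ℝ) (S : ℝ → D.L2) : Prop :=
  D.IsSolution I f S ∧
    ∀ T : ℝ → D.L2, D.IsSolution I f T ↔ D.IsSolution I (fun _ => 0) (fun z => T z - S z)

end Setting

/-- The viscous source `μ |∇h|²`. -/
def viscousSource (μ : Plane → ℝ) (gradh : Plane → Plane) : Plane → ℝ :=
  fun x => μ x * ‖gradh x‖ ^ 2

end Graetz

end

noncomputable section

namespace Graetz

/-! ### One-dimensional estimates -/

/-! Equation (1) is affine in `T`, so once `T̃` is known to be one solution, adding or subtracting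
it passes between (1) and (2) (`reduces_of_isSolution`). Everything rests on two points: the
inverses `Δ_σ⁻¹` exist, and `T̃` satisfies (1).

That `T̃` solves (1) is a cancellation. In case a) it does not depend on `z`. In case b) `div (σ
∇T̃) = f + α h` while `h ∂_z T̃ = α h`. In case c) `c ∂_zz T̃ = α c`, `div (σ ∇T̃) = α z h + f - α
(c - h w)` and `h ∂_z T̃ = α h (z + w)`, with sum `f`. The number `α` is what gives the remaining
source zero average; in case c) it exists because testing the equation of `w` with `w` itself gives
`∫ σ |∇w|² = -∫ h w`.

The inverses come from Lax–Milgram (`exists_forall_eq_of_coercive`). A function, its gradient and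
its trace form one vector of `L² × L² × L²`; the admissible vectors form a closed subspace `V`, cut
out of the closure of the smooth functions by the boundary conditions. Coercivity follows from the
Poincaré inequality with a free constant and the trace inequality. Both are proved for smooth
functions below a Lipschitz graph by integrating along horizontal and vertical segments, are
globalized by compactness (and by connectedness for Poincaré), and pass to the closure by
continuity. If the constants are controlled, the boundary term bounds the mean and the energy is
coercive on `V`. Otherwise it is coercive on the part `V₀` of zero mean, and constants belong to `V`
with zero energy: the source must have zero average, and the solution is unique up to a constant. -/

/-- Fundamental theorem of calculus followed by Cauchy–Schwarz. -/
theorem enorm_sub_sq_le_lintegral_deriv {v : ℝ → ℝ} (hv : ContDiff ℝ 1 v) {A B p q : ℝ}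
    (hp : p ∈ Set.Icc A B) (hq : q ∈ Set.Icc A B) :
    ‖v p - v q‖ₑ ^ 2 ≤ ENNReal.ofReal (B - A) * ∫⁻ t in Set.Ioo A B, ‖deriv v t‖ₑ ^ 2 := by
  have hcont : Continuous (deriv v) := hv.continuous_deriv le_rfl
  have h1 : ‖v p - v q‖ₑ ≤ ∫⁻ t in Set.Ioo A B, ‖deriv v t‖ₑ := by
    have : v p - v q = ∫ t in q..p, deriv v t :=
      (intervalIntegral.integral_deriv_eq_sub
        (fun x _ => (hv.differentiable one_ne_zero).differentiableAt)
        (hcont.intervalIntegrable _ _)).symm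
    rw [this, Measure.restrict_congr_set Ioo_ae_eq_Ioc]
    calc ‖∫ t in q..p, deriv v t‖ₑ = ‖∫ t in Set.uIoc q p, deriv v t‖ₑ := by
          rw [← ofReal_norm, ← ofReal_norm, intervalIntegral.norm_intervalIntegral_eq]
      _ ≤ ∫⁻ t in Set.uIoc q p, ‖deriv v t‖ₑ := enorm_integral_le_lintegral_enorm _
      _ ≤ _ := lintegral_mono_set (by
          intro x hx
          rcases Set.mem_uIoc.1 hx with h | h
          · exact ⟨hq.1.trans_lt h.1, h.2.trans hp.2⟩
          · exact ⟨hp.1.trans_lt h.1, h.2.trans hq.2⟩)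
  have h2 := ENNReal.lintegral_mul_le_Lp_mul_Lq (volume.restrict (Set.Ioo A B))
    (p := 2) (q := 2) Real.HolderConjugate.two_two
    (f := fun _ => (1 : ℝ≥0∞)) (g := fun t => ‖deriv v t‖ₑ) aemeasurable_const
    hcont.enorm.measurable.aemeasurable
  have h3 : ∫⁻ t in Set.Ioo A B, ‖deriv v t‖ₑ ≤
      (ENNReal.ofReal (B - A)) ^ (1 / 2 : ℝ) *
        (∫⁻ t in Set.Ioo A B, ‖deriv v t‖ₑ ^ 2) ^ (1 / 2 : ℝ) := by
    simpa using h2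
  calc ‖v p - v q‖ₑ ^ 2 ≤ ((ENNReal.ofReal (B - A)) ^ (1 / 2 : ℝ) *
        (∫⁻ t in Set.Ioo A B, ‖deriv v t‖ₑ ^ 2) ^ (1 / 2 : ℝ)) ^ 2 := by
        gcongr; exact h1.trans h3
    _ = _ := by
        rw [mul_pow, ← ENNReal.rpow_natCast, ← ENNReal.rpow_mul, ← ENNReal.rpow_natCast,
          ← ENNReal.rpow_mul]
        norm_num

theorem enorm_add_sq_le (a b : ℝ) : ‖a + b‖ₑ ^ 2 ≤ 2 * ‖a‖ₑ ^ 2 + 2 * ‖b‖ₑ ^ 2 := by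
  have h : (a + b) ^ 2 ≤ 2 * a ^ 2 + 2 * b ^ 2 := by nlinarith [sq_nonneg (a - b)]
  have e : ∀ x : ℝ, ‖x‖ₑ ^ 2 = ENNReal.ofReal (x ^ 2) := fun x => by
    rw [← ofReal_norm, ← ENNReal.ofReal_pow (norm_nonneg _), Real.norm_eq_abs, sq_abs]
  rw [e, e, e, ← ENNReal.ofReal_ofNat 2, ← ENNReal.ofReal_mul (by norm_num),
    ← ENNReal.ofReal_mul (by norm_num), ← ENNReal.ofReal_add (by positivity) (by positivity)]
  exact ENNReal.ofReal_le_ofReal h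

/-! ### Charts -/

/-- The inverse of the coordinate map `x ↦ ((e x) 0, (e x) 1)`. -/
def chart (e : Plane ≃ₗᵢ[ℝ] Plane) (p : ℝ × ℝ) : Plane := e.symm !₂[p.1, p.2]

variable (e : Plane ≃ₗᵢ[ℝ] Plane)

@[simp] theorem apply_chart_zero (p : ℝ × ℝ) : (e (chart e p)) 0 = p.1 := by simp [chart]

@[simp] theorem apply_chart_one (p : ℝ × ℝ) : (e (chart e p)) 1 = p.2 := by simp [chart]

theorem chart_apply (x : Plane) : chart e ((e x) 0, (e x) 1) = x := by
  have : (!₂[(e x) 0, (e x) 1] : Plane) = e x := by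
    ext i; fin_cases i <;> rfl
  simp [chart, this]

theorem chart_sub (p q : ℝ × ℝ) : chart e p - chart e q = chart e (p - q) := by
  rw [chart, chart, chart, ← map_sub]
  congr 1
  ext i; fin_cases i <;> simp

theorem measurePreserving_chart : MeasurePreserving (chart e) := by
  have h1 := (volume_preserving_finTwoArrow ℝ).symm
  have h2 := (PiLp.volume_preserving_toLp (Fin 2))
  have h3 := e.symm.measurePreserving
  exact h3.comp (h2.comp h1)

theorem norm_chart_le (p : ℝ × ℝ) : ‖chart e p‖ ≤ |p.1| + |p.2| := by
  rw [chart, LinearIsometryEquiv.norm_map, EuclideanSpace.norm_eq]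
  apply Real.sqrt_le_iff.2 ⟨by positivity, ?_⟩
  simp only [Fin.sum_univ_two, Real.norm_eq_abs]
  simp
  nlinarith [abs_nonneg p.1, abs_nonneg p.2, sq_abs p.1, sq_abs p.2]

theorem contDiff_chart {n : WithTop ℕ∞} : ContDiff ℝ n (chart e) := by
  unfold chart
  apply e.symm.toContinuousLinearEquiv.contDiff.comp
  rw [contDiff_euclidean]
  intro i; fin_cases i
  · exact contDiff_fst
  · exact contDiff_snd

theorem norm_deriv_comp_le {u : Plane → ℝ} (hu : ContDiff ℝ ∞ u) {γ : ℝ → Plane} {d : Plane}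
    {t : ℝ} (hγ : HasDerivAt γ d t) (hd : ‖d‖ ≤ 1) :
    ‖deriv (fun t => u (γ t)) t‖ₑ ≤ ‖gradient u (γ t)‖ₑ := by
  have hdu : DifferentiableAt ℝ u (γ t) := (hu.differentiable (by simp)).differentiableAt
  have h := hdu.hasFDerivAt.comp_hasDerivAt t hγ
  rw [show (fun t => u (γ t)) = u ∘ γ from rfl, h.deriv, enorm_le_iff_norm_le]
  calc ‖fderiv ℝ u (γ t) d‖ ≤ ‖fderiv ℝ u (γ t)‖ * ‖d‖ := ContinuousLinearMap.le_opNorm _ _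
    _ ≤ ‖fderiv ℝ u (γ t)‖ * 1 := by gcongr
    _ = ‖gradient u (γ t)‖ := by rw [mul_one, gradient, LinearIsometryEquiv.norm_map]

theorem hasDerivAt_chart_fst (s t : ℝ) :
    HasDerivAt (fun s => chart e (s, t)) (chart e (1, 0)) s := by
  have : (fun s => chart e (s, t)) = fun s => chart e (0, t) + s • chart e (1, 0) := by
    funext s
    rw [chart, chart, chart, ← map_smul, ← map_add]
    congr 1
    ext i; fin_cases i <;> simp
  rw [this]
  simpa using ((hasDerivAt_id s).smul_const (chart e (1, 0))).const_add (chart e (0, t))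

theorem hasDerivAt_chart_snd (s t : ℝ) :
    HasDerivAt (fun t => chart e (s, t)) (chart e (0, 1)) t := by
  have : (fun t => chart e (s, t)) = fun t => chart e (s, 0) + t • chart e (0, 1) := by
    funext s
    rw [chart, chart, chart, ← map_smul, ← map_add]
    congr 1
    ext i; fin_cases i <;> simp
  rw [this]
  simpa using ((hasDerivAt_id t).smul_const (chart e (0, 1))).const_add (chart e (s, 0))

theorem enorm_chart_sub_sq_le_vertical {u : Plane → ℝ} (hu : ContDiff ℝ ∞ u) (s : ℝ) {A B p q : ℝ}
    (hp : p ∈ Set.Icc A B) (hq : q ∈ Set.Icc A B) :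
    ‖u (chart e (s, p)) - u (chart e (s, q))‖ₑ ^ 2 ≤
      ENNReal.ofReal (B - A) * ∫⁻ t in Set.Ioo A B, ‖gradient u (chart e (s, t))‖ₑ ^ 2 := by
  have hv : ContDiff ℝ 1 (fun t => u (chart e (s, t))) :=
    (hu.of_le (by simp)).comp ((contDiff_chart e).comp (contDiff_const.prodMk contDiff_id))
  refine (enorm_sub_sq_le_lintegral_deriv hv hp hq).trans ?_
  gcongr with t
  exact norm_deriv_comp_le hu (hasDerivAt_chart_snd e s t) (by simpa using norm_chart_le e (0, 1))

theorem enorm_chart_sub_sq_le_horizontal {u : Plane → ℝ} (hu : ContDiff ℝ ∞ u) (t : ℝ)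
    {A B p q : ℝ} (hp : p ∈ Set.Icc A B) (hq : q ∈ Set.Icc A B) :
    ‖u (chart e (p, t)) - u (chart e (q, t))‖ₑ ^ 2 ≤
      ENNReal.ofReal (B - A) * ∫⁻ s in Set.Ioo A B, ‖gradient u (chart e (s, t))‖ₑ ^ 2 := by
  have hv : ContDiff ℝ 1 (fun s => u (chart e (s, t))) :=
    (hu.of_le (by simp)).comp ((contDiff_chart e).comp (contDiff_id.prodMk contDiff_const))
  refine (enorm_sub_sq_le_lintegral_deriv hv hp hq).trans ?_
  gcongr with s
  exact norm_deriv_comp_le hu (hasDerivAt_chart_fst e s t) (by simpa using norm_chart_le e (1, 0))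

theorem continuous_gradient {u : Plane → ℝ} (hu : ContDiff ℝ ∞ u) : Continuous (gradient u) := by
  unfold gradient
  exact (InnerProductSpace.toDual ℝ Plane).symm.continuous.comp (hu.continuous_fderiv (by simp))

/-- The part of the strip `s₁ < s < s₂` between the line `t = t₁` and the graph `t = b s`. -/
def subgraph (s₁ s₂ t₁ : ℝ) (b : ℝ → ℝ) : Set (ℝ × ℝ) :=
  {p | p.1 ∈ Set.Ioo s₁ s₂ ∧ p.2 ∈ Set.Ioo t₁ (b p.1)}

theorem measurableSet_subgraph (s₁ s₂ t₁ : ℝ) {b : ℝ → ℝ} (hb : Measurable b) :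
    MeasurableSet (subgraph s₁ s₂ t₁ b) := by
  refine (measurable_fst measurableSet_Ioo).inter (MeasurableSet.inter ?_ ?_)
  · exact measurableSet_lt measurable_const measurable_snd
  · exact measurableSet_lt measurable_snd (hb.comp measurable_fst)

theorem lintegral_subgraph (s₁ s₂ t₁ : ℝ) {b : ℝ → ℝ} (hb : Measurable b) {F : ℝ × ℝ → ℝ≥0∞}
    (hF : Measurable F) :
    ∫⁻ p in subgraph s₁ s₂ t₁ b, F p =
      ∫⁻ s in Set.Ioo s₁ s₂, ∫⁻ t in Set.Ioo t₁ (b s), F (s, t) := by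
  have hm := measurableSet_subgraph s₁ s₂ t₁ hb
  rw [← lintegral_indicator hm, Measure.volume_eq_prod,
    lintegral_prod _ (hF.indicator hm).aemeasurable, ← lintegral_indicator measurableSet_Ioo]
  congr 1 with s
  by_cases hs : s ∈ Set.Ioo s₁ s₂
  · rw [Set.indicator_of_mem hs, ← lintegral_indicator measurableSet_Ioo]
    congr 1 with t
    by_cases ht : t ∈ Set.Ioo t₁ (b s)
    · rw [Set.indicator_of_mem ht,
        Set.indicator_of_mem (show (s, t) ∈ subgraph s₁ s₂ t₁ b from ⟨hs, ht⟩)]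
    · rw [Set.indicator_of_notMem ht, Set.indicator_of_notMem (fun h => ht h.2)]
  · rw [Set.indicator_of_notMem hs]
    rw [← lintegral_zero (μ := (volume : Measure ℝ))]
    congr 1 with t
    rw [Set.indicator_of_notMem (fun h => hs h.1)]

end Graetz
end

/-! ### Poincaré and trace inequalities below a graph -/

noncomputable section

namespace Graetz

variable (e : Plane ≃ₗᵢ[ℝ] Plane)

theorem measurable_enorm_gradient_sq_chart {u : Plane → ℝ} (hu : ContDiff ℝ ∞ u) :
    Measurable fun p => ‖gradient u (chart e p)‖ₑ ^ 2 :=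
  ((continuous_gradient hu).comp (contDiff_chart (n := 0) e).continuous).enorm.measurable.pow_const 2

theorem measurable_lintegral_Ioo (t₁ : ℝ) {b : ℝ → ℝ} (hb : Measurable b) {F : ℝ × ℝ → ℝ≥0∞}
    (hF : Measurable F) : Measurable fun s => ∫⁻ t in Set.Ioo t₁ (b s), F (s, t) := by
  have hm : MeasurableSet {p : ℝ × ℝ | p.2 ∈ Set.Ioo t₁ (b p.1)} :=
    (measurableSet_lt measurable_const measurable_snd).inter
      (measurableSet_lt measurable_snd (hb.comp measurable_fst))
  have h := (hF.indicator hm).lintegral_prod_right' (ν := volume)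
  convert h using 2 with s
  rw [← lintegral_indicator measurableSet_Ioo]
  rfl

/-- Below height `t₂` all horizontal rows cross the whole region, and by averaging one of them
carries at most the share `K⁻¹ * E` of the energy. Each point is joined to the midpoint of that row
by a vertical and then a horizontal segment, on which the one-dimensional estimate applies. The
value of `u` at this midpoint serves as `m`. -/
theorem poincare_subgraph {s₁ s₂ t₁ t₂ B : ℝ} {b : ℝ → ℝ} (hb : Measurable b) (hs : s₁ < s₂)
    (ht : t₁ < t₂) (hb₁ : ∀ s ∈ Set.Ioo s₁ s₂, t₂ ≤ b s) (hb₂ : ∀ s ∈ Set.Ioo s₁ s₂, b s ≤ B) :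
    ∃ C : ℝ≥0∞, C ≠ ⊤ ∧ ∀ u : Plane → ℝ, ContDiff ℝ ∞ u → ∃ m : ℝ,
      ∫⁻ p in subgraph s₁ s₂ t₁ b, ‖u (chart e p) - m‖ₑ ^ 2 ≤
        C * ∫⁻ p in subgraph s₁ s₂ t₁ b, ‖gradient u (chart e p)‖ₑ ^ 2 := by
  set H := ENNReal.ofReal (B - t₁) with hH
  set S := ENNReal.ofReal (s₂ - s₁) with hS
  set K := ENNReal.ofReal (t₂ - t₁) with hK
  have hK0 : K ≠ 0 := by simpa [hK] using ht
  have hKt : K ≠ ⊤ := ENNReal.ofReal_ne_top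
  -- The first summand is the cost of the vertical segments, the second that of the horizontal ones;
  -- the outer factors `H` and `S * H` come from integrating over the region.
  refine ⟨H * (2 * H) + S * (H * (2 * (S * K⁻¹))), ?_, fun u hu => ?_⟩
  · have : K⁻¹ ≠ ⊤ := ENNReal.inv_ne_top.2 hK0
    finiteness
  set E := ∫⁻ p in subgraph s₁ s₂ t₁ b, ‖gradient u (chart e p)‖ₑ ^ 2 with hE
  have hmeas := measurable_enorm_gradient_sq_chart e hu
  have hEs : E = ∫⁻ s in Set.Ioo s₁ s₂, ∫⁻ t in Set.Ioo t₁ (b s),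
      ‖gradient u (chart e (s, t))‖ₑ ^ 2 := lintegral_subgraph s₁ s₂ t₁ hb hmeas
  have hrow : ∃ t' ∈ Set.Ioo t₁ t₂,
      ∫⁻ s in Set.Ioo s₁ s₂, ‖gradient u (chart e (s, t'))‖ₑ ^ 2 ≤ K⁻¹ * E := by
    have hm' : Measurable fun t => ∫⁻ s in Set.Ioo s₁ s₂, ‖gradient u (chart e (s, t))‖ₑ ^ 2 :=
      Measurable.lintegral_prod_left' hmeas
    have hvol : volume (Set.Ioo t₁ t₂) = K := Real.volume_Ioo
    obtain ⟨t', ht', hle⟩ := exists_le_setLAverage (μ := volume) (s := Set.Ioo t₁ t₂)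
      (by rwa [hvol]) (by rwa [hvol]) hm'.aemeasurable
    refine ⟨t', ht', hle.trans ?_⟩
    rw [setLAverage_eq, hvol, ENNReal.div_eq_inv_mul]
    gcongr
    rw [hEs, lintegral_lintegral_swap]
    · refine setLIntegral_mono' measurableSet_Ioo fun s hs => ?_
      exact lintegral_mono_set (Set.Ioo_subset_Ioo_right (hb₁ s hs))
    · exact (hmeas.comp measurable_swap).aemeasurable
  obtain ⟨t', ht', hrow⟩ := hrow
  refine ⟨u (chart e ((s₁ + s₂) / 2, t')), ?_⟩
  have hmv : Measurable fun p => ‖u (chart e p) - u (chart e ((s₁ + s₂) / 2, t'))‖ₑ ^ 2 :=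
    ((hu.continuous.comp (contDiff_chart (n := 0) e).continuous).sub
      continuous_const).enorm.measurable.pow_const 2
  rw [lintegral_subgraph s₁ s₂ t₁ hb hmv]
  have key : ∀ s ∈ Set.Ioo s₁ s₂, ∀ t ∈ Set.Ioo t₁ (b s),
      ‖u (chart e (s, t)) - u (chart e ((s₁ + s₂) / 2, t'))‖ₑ ^ 2 ≤
        2 * (H * ∫⁻ t in Set.Ioo t₁ (b s), ‖gradient u (chart e (s, t))‖ₑ ^ 2) +
          2 * (S * (K⁻¹ * E)) := by
    intro s hs' t ht''
    have h1 := enorm_chart_sub_sq_le_vertical e hu s (A := t₁) (B := b s) (p := t) (q := t')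
      (Set.Ioo_subset_Icc_self ht'') ⟨ht'.1.le, ht'.2.le.trans (hb₁ s hs')⟩
    have h2 := enorm_chart_sub_sq_le_horizontal e hu t' (A := s₁) (B := s₂) (p := s)
      (q := (s₁ + s₂) / 2) (Set.Ioo_subset_Icc_self hs') ⟨by linarith, by linarith⟩
    have h3 := enorm_add_sq_le (u (chart e (s, t)) - u (chart e (s, t')))
      (u (chart e (s, t')) - u (chart e ((s₁ + s₂) / 2, t')))
    rw [sub_add_sub_cancel] at h3
    refine h3.trans ?_
    gcongr
    · refine h1.trans ?_
      gcongr
      exact ENNReal.ofReal_le_ofReal (by linarith [hb₂ s hs'])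
    · refine h2.trans ?_
      gcongr
  calc _ ≤ ∫⁻ s in Set.Ioo s₁ s₂, H *
        (2 * (H * ∫⁻ t in Set.Ioo t₁ (b s), ‖gradient u (chart e (s, t))‖ₑ ^ 2) +
          2 * (S * (K⁻¹ * E))) := by
        refine setLIntegral_mono' measurableSet_Ioo fun s hs' => ?_
        refine (setLIntegral_mono' measurableSet_Ioo (key s hs')).trans ?_
        rw [setLIntegral_const, mul_comm, Real.volume_Ioo]
        gcongr
        exact ENNReal.ofReal_le_ofReal (by linarith [hb₂ s hs'])
    _ = H * (2 * H) * E + S * (H * (2 * (S * K⁻¹))) * E := by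
        simp_rw [mul_add]
        rw [lintegral_add_right _ measurable_const, setLIntegral_const, Real.volume_Ioo]
        congr 1
        · simp_rw [← mul_assoc]
          rw [lintegral_const_mul' _ _ (by finiteness), ← hEs]
        · ring
    _ = _ := by ring

/-- The value on the graph differs from the value at a height `τ` of the same vertical line by at
most the energy on that line. Averaging over `τ` between `t₁` and `t₂`, a band that lies inside the
region, replaces the value at `τ` by the `L²` norm. -/
theorem trace_subgraph {s₁ s₂ t₁ t₂ B : ℝ} {b : ℝ → ℝ} (hb : Measurable b)
    (ht : t₁ < t₂) (hb₁ : ∀ s ∈ Set.Ioo s₁ s₂, t₂ ≤ b s) (hb₂ : ∀ s ∈ Set.Ioo s₁ s₂, b s ≤ B) :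
    ∃ C : ℝ≥0∞, C ≠ ⊤ ∧ ∀ u : Plane → ℝ, ContDiff ℝ ∞ u →
      ∫⁻ s in Set.Ioo s₁ s₂, ‖u (chart e (s, b s))‖ₑ ^ 2 ≤
        C * ((∫⁻ p in subgraph s₁ s₂ t₁ b, ‖u (chart e p)‖ₑ ^ 2) +
          ∫⁻ p in subgraph s₁ s₂ t₁ b, ‖gradient u (chart e p)‖ₑ ^ 2) := by
  set H := ENNReal.ofReal (B - t₁) with hH
  set K := ENNReal.ofReal (t₂ - t₁) with hK
  have hK0 : K ≠ 0 := by simpa [hK] using ht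
  have hKt : K ≠ ⊤ := ENNReal.ofReal_ne_top
  have hKi : K⁻¹ ≠ ⊤ := ENNReal.inv_ne_top.2 hK0
  refine ⟨K⁻¹ * 2 + 2 * H, by finiteness, fun u hu => ?_⟩
  have hmg := measurable_enorm_gradient_sq_chart e hu
  have hmu : Measurable fun p => ‖u (chart e p)‖ₑ ^ 2 :=
    (hu.continuous.comp (contDiff_chart (n := 0) e).continuous).enorm.measurable.pow_const 2
  rw [lintegral_subgraph s₁ s₂ t₁ hb hmg, lintegral_subgraph s₁ s₂ t₁ hb hmu]
  set U := ∫⁻ s in Set.Ioo s₁ s₂, ∫⁻ t in Set.Ioo t₁ (b s), ‖u (chart e (s, t))‖ₑ ^ 2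
  set E := ∫⁻ s in Set.Ioo s₁ s₂, ∫⁻ t in Set.Ioo t₁ (b s), ‖gradient u (chart e (s, t))‖ₑ ^ 2
  have key : ∀ s ∈ Set.Ioo s₁ s₂, ‖u (chart e (s, b s))‖ₑ ^ 2 ≤
      K⁻¹ * 2 * (∫⁻ t in Set.Ioo t₁ (b s), ‖u (chart e (s, t))‖ₑ ^ 2) +
        2 * H * ∫⁻ t in Set.Ioo t₁ (b s), ‖gradient u (chart e (s, t))‖ₑ ^ 2 := by
    intro s hs
    set J := ∫⁻ t in Set.Ioo t₁ (b s), ‖gradient u (chart e (s, t))‖ₑ ^ 2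
    have h1 : ∀ τ ∈ Set.Ioo t₁ t₂, ‖u (chart e (s, b s))‖ₑ ^ 2 ≤
        2 * (H * J) + 2 * ‖u (chart e (s, τ))‖ₑ ^ 2 := by
      intro τ hτ
      have h2 := enorm_chart_sub_sq_le_vertical e hu s (A := t₁) (B := b s) (p := b s) (q := τ)
        ⟨ht.le.trans (hb₁ s hs), le_rfl⟩ ⟨hτ.1.le, hτ.2.le.trans (hb₁ s hs)⟩
      have h3 := enorm_add_sq_le (u (chart e (s, b s)) - u (chart e (s, τ))) (u (chart e (s, τ)))
      rw [sub_add_cancel] at h3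
      refine h3.trans ?_
      gcongr
      refine h2.trans ?_
      gcongr
      exact ENNReal.ofReal_le_ofReal (by linarith [hb₂ s hs])
    have h4 := setLIntegral_mono' (μ := volume) measurableSet_Ioo h1
    rw [setLIntegral_const, Real.volume_Ioo, lintegral_add_left measurable_const,
      setLIntegral_const, Real.volume_Ioo, lintegral_const_mul' _ _ (by finiteness), ← hK] at h4
    calc ‖u (chart e (s, b s))‖ₑ ^ 2 = K⁻¹ * (‖u (chart e (s, b s))‖ₑ ^ 2 * K) := by
          rw [mul_comm _ K, ← mul_assoc, ENNReal.inv_mul_cancel hK0 hKt, one_mul]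
      _ ≤ K⁻¹ * (2 * (H * J) * K + 2 * ∫⁻ τ in Set.Ioo t₁ t₂, ‖u (chart e (s, τ))‖ₑ ^ 2) := by
          gcongr
      _ = K⁻¹ * 2 * (∫⁻ τ in Set.Ioo t₁ t₂, ‖u (chart e (s, τ))‖ₑ ^ 2) +
            (K⁻¹ * K) * (2 * H * J) := by ring
      _ ≤ _ := by
          rw [ENNReal.inv_mul_cancel hK0 hKt, one_mul]
          gcongr
          exact hb₁ s hs
  calc _ ≤ K⁻¹ * 2 * U + 2 * H * E := by
        refine (setLIntegral_mono' measurableSet_Ioo key).trans ?_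
        rw [lintegral_add_left', lintegral_const_mul' _ _ (by finiteness),
          lintegral_const_mul' _ _ (by finiteness)]
        refine Measurable.aemeasurable (Measurable.const_mul ?_ _)
        exact measurable_lintegral_Ioo t₁ hb hmu
    _ ≤ (K⁻¹ * 2 + 2 * H) * U + (K⁻¹ * 2 + 2 * H) * E := by
        gcongr
        · exact le_self_add
        · exact le_add_self
    _ = _ := by ring

end Graetz
end

/-! ### Local charts of a Lipschitz domain -/

noncomputable section

namespace Graetz

/-- A box `U` in rotated coordinates in which `Ω` is the part of the box below a Lipschitz graph and
`∂Ω` is part of this graph. -/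
structure LocalChart (Ω : Set Plane) (U : Set Plane) where
  e : Plane ≃ₗᵢ[ℝ] Plane
  s₁ : ℝ
  s₂ : ℝ
  t₁ : ℝ
  t₂ : ℝ
  B : ℝ
  b : ℝ → ℝ
  K : ℝ≥0
  lipschitz : LipschitzWith K b
  s_lt : s₁ < s₂
  t_lt : t₁ < t₂
  le_b : ∀ s ∈ Set.Ioo s₁ s₂, t₂ ≤ b s
  b_le : ∀ s ∈ Set.Ioo s₁ s₂, b s ≤ B
  chart_mem : ∀ p ∈ subgraph s₁ s₂ t₁ b, chart e p ∈ Ω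
  coord_mem : ∀ x ∈ U ∩ Ω, ((e x) 0, (e x) 1) ∈ subgraph s₁ s₂ t₁ b
  fst_mem_of_frontier : ∀ x ∈ U ∩ frontier Ω, (e x) 0 ∈ Set.Ioo s₁ s₂
  snd_eq_of_frontier : ∀ x ∈ U ∩ frontier Ω, (e x) 1 = b ((e x) 0)

/-- The open box with center `p` and half sides `δ`, `ℓ` in the coordinates given by `e`. -/
def box (e : Plane ≃ₗᵢ[ℝ] Plane) (p : Plane) (δ ℓ : ℝ) : Set Plane :=
  {x | |(e x) 0 - (e p) 0| < δ ∧ |(e x) 1 - (e p) 1| < ℓ}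

theorem continuous_coord (e : Plane ≃ₗᵢ[ℝ] Plane) (i : Fin 2) : Continuous fun x => (e x) i :=
  (EuclideanSpace.proj i).continuous.comp e.continuous

theorem isOpen_box (e : Plane ≃ₗᵢ[ℝ] Plane) (p : Plane) (δ ℓ : ℝ) : IsOpen (box e p δ ℓ) :=
  (isOpen_lt ((continuous_coord e 0).sub continuous_const).abs continuous_const).inter
    (isOpen_lt ((continuous_coord e 1).sub continuous_const).abs continuous_const)

theorem box_subset_ball (e : Plane ≃ₗᵢ[ℝ] Plane) (p : Plane) {δ ℓ r : ℝ} (h : δ + ℓ ≤ r) :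
    box e p δ ℓ ⊆ Metric.ball p r := by
  intro x hx
  rw [mem_ball_iff_norm, ← chart_apply e x, ← chart_apply e p, chart_sub]
  refine (norm_chart_le e _).trans_lt ?_
  have := hx.1
  have := hx.2
  simp only [Prod.mk_sub_mk]
  linarith

/-- An interior point gets a box inside `Ω`, with a constant `b` and no boundary. At a boundary
point the box is chosen so flat that the graph leaves it neither through the top nor through the
bottom. -/
theorem exists_localChart {Ω : Set Plane} (ho : IsOpen Ω) (hl : HasLipschitzBoundary Ω) {p : Plane}
    (hp : p ∈ closure Ω) : ∃ U, IsOpen U ∧ p ∈ U ∧ Nonempty (LocalChart Ω U) := by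
  by_cases hpo : p ∈ Ω
  · obtain ⟨r, hr, hball⟩ := Metric.isOpen_iff.1 ho p hpo
    let e := LinearIsometryEquiv.refl ℝ Plane
    have hsub : box e p (r / 2) (r / 2) ⊆ Ω :=
      (box_subset_ball e p (by linarith)).trans hball
    have hfr : ∀ x ∈ box e p (r / 2) (r / 2) ∩ frontier Ω, False := fun x hx =>
      Set.disjoint_left.1 (disjoint_frontier_iff_isOpen.2 ho) (hx.2) (hsub hx.1)
    refine ⟨box e p (r / 2) (r / 2), isOpen_box _ _ _ _, by simp [box, hr], ⟨{
      e := e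
      s₁ := p 0 - r / 2
      s₂ := p 0 + r / 2
      t₁ := p 1 - r / 2
      t₂ := p 1 + r / 2
      B := p 1 + r / 2
      b := fun _ => p 1 + r / 2
      K := 0
      lipschitz := LipschitzWith.const _
      s_lt := by linarith
      t_lt := by linarith
      le_b := fun _ _ => le_rfl
      b_le := fun _ _ => le_rfl
      chart_mem := fun q hq => hsub ?_
      coord_mem := fun x hx => ?_
      fst_mem_of_frontier := fun x hx => (hfr x hx).elim
      snd_eq_of_frontier := fun x hx => (hfr x hx).elim }⟩⟩
    · obtain ⟨⟨h1, h2⟩, h3, h4⟩ := hq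
      have : (e p) = p := rfl
      refine ⟨?_, ?_⟩
      · rw [apply_chart_zero, this, abs_sub_lt_iff]; constructor <;> linarith
      · rw [apply_chart_one, this, abs_sub_lt_iff]; constructor <;> linarith
    · obtain ⟨h1, h2⟩ := hx.1
      rw [abs_sub_lt_iff] at h1 h2
      have : (e p) = p := rfl
      rw [this] at h1 h2
      exact ⟨⟨by linarith, by linarith⟩, by linarith, by linarith⟩
  · have hpf : p ∈ frontier Ω := by rw [ho.frontier_eq]; exact ⟨hp, hpo⟩
    obtain ⟨e, K, b, r, hb, hr, hΩ⟩ := hl p hpf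
    -- A point strictly below the graph lies in the open set `Ω`, hence off its frontier; a point
    -- strictly above it has a neighbourhood that misses `Ω`.
    have hfr : ∀ x ∈ Metric.ball p r ∩ frontier Ω, (e x) 1 = b ((e x) 0) := by
      intro x hx
      rcases lt_trichotomy ((e x) 1) (b ((e x) 0)) with h | h | h
      · exact (Set.disjoint_left.1 (disjoint_frontier_iff_isOpen.2 ho) hx.2
          ((hΩ x hx.1).2 h)).elim
      · exact h
      · have hopen : IsOpen (Metric.ball p r ∩ {y | b ((e y) 0) < (e y) 1}) :=
          Metric.isOpen_ball.inter
            (isOpen_lt (hb.continuous.comp (continuous_coord e 0)) (continuous_coord e 1))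
        obtain ⟨y, hy, hyΩ⟩ := mem_closure_iff.1 (frontier_subset_closure hx.2) _ hopen ⟨hx.1, h⟩
        exact absurd ((hΩ y hy.1).1 hyΩ) (not_lt.2 (le_of_lt hy.2))
    have hpb : (e p) 1 = b ((e p) 0) := hfr p ⟨Metric.mem_ball_self hr, hpf⟩
    -- Over the width `δ` the graph varies by at most `K * δ`. With `ℓ = (2 * K + 1) * δ` the box
    -- leaves room above and below it, and `δ + ℓ = r` keeps the box inside the ball.
    set δ : ℝ := r / (2 * K + 2) with hδ
    have hKp : (0 : ℝ) ≤ K := K.2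
    have hδ0 : 0 < δ := by positivity
    have hδr : δ + (2 * K + 1) * δ = r := by rw [hδ]; field_simp; ring
    have hKδ : 0 ≤ K * δ := by positivity
    have hbs : ∀ s, |s - (e p) 0| < δ → |b s - b ((e p) 0)| ≤ K * δ := by
      intro s hs
      have := hb.dist_le_mul s ((e p) 0)
      rw [Real.dist_eq, Real.dist_eq] at this
      exact this.trans (by gcongr)
    have hbs' : ∀ s ∈ Set.Ioo ((e p) 0 - δ) ((e p) 0 + δ), |b s - b ((e p) 0)| ≤ K * δ :=
      fun s hs => hbs s (abs_sub_lt_iff.2 ⟨by linarith [hs.2], by linarith [hs.1]⟩)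
    set ℓ := (2 * K + 1) * δ with hℓ
    have hsub : box e p δ ℓ ⊆ Metric.ball p r := box_subset_ball e p hδr.le
    refine ⟨box e p δ ℓ, isOpen_box _ _ _ _, by simp [box, hδ0, hℓ]; positivity, ⟨{
      e := e
      s₁ := (e p) 0 - δ
      s₂ := (e p) 0 + δ
      t₁ := (e p) 1 - ℓ
      t₂ := (e p) 1 - K * δ
      B := (e p) 1 + K * δ
      b := b
      K := K
      lipschitz := hb
      s_lt := by linarith
      t_lt := by rw [hℓ]; linarith
      le_b := fun s hs => by have := abs_le.1 (hbs' s hs); rw [hpb]; linarith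
      b_le := fun s hs => by have := abs_le.1 (hbs' s hs); rw [hpb]; linarith
      chart_mem := fun q hq => ?_
      coord_mem := fun x hx => ?_
      fst_mem_of_frontier := fun x hx => ?_
      snd_eq_of_frontier := fun x hx => hfr x ⟨hsub hx.1, hx.2⟩ }⟩⟩
    · obtain ⟨h1, h3, h4⟩ := hq
      have h5 := abs_le.1 (hbs' _ h1)
      have hmem : chart e q ∈ box e p δ ℓ := by
        refine ⟨?_, ?_⟩
        · rw [apply_chart_zero, abs_sub_lt_iff]; constructor <;> linarith [h1.1, h1.2]
        · rw [apply_chart_one, abs_sub_lt_iff]; constructor <;> linarith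
      exact (hΩ _ (hsub hmem)).2 (by simpa using h4)
    · obtain ⟨h1, h2⟩ := hx.1
      rw [abs_sub_lt_iff] at h1 h2
      exact ⟨⟨by linarith, by linarith⟩, by linarith, (hΩ _ (hsub hx.1)).1 hx.2⟩
    · have h1 := hx.1.1
      rw [abs_sub_lt_iff] at h1
      exact ⟨by linarith, by linarith⟩

namespace LocalChart

variable {Ω U : Set Plane} (c : LocalChart Ω U)

/-- The part of `Ω` that the chart covers. -/
def region : Set Plane := {x | ((c.e x) 0, (c.e x) 1) ∈ subgraph c.s₁ c.s₂ c.t₁ c.b}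

theorem region_subset : c.region ⊆ Ω := fun x hx => by
  simpa [chart_apply] using c.chart_mem _ hx

theorem inter_subset_region : U ∩ Ω ⊆ c.region := fun x hx => c.coord_mem x hx

theorem measurable_b : Measurable c.b := c.lipschitz.continuous.measurable

theorem lintegral_region {F : Plane → ℝ≥0∞} (hF : Measurable F) :
    ∫⁻ x in c.region, F x = ∫⁻ p in subgraph c.s₁ c.s₂ c.t₁ c.b, F (chart c.e p) := by
  have hm : MeasurableSet c.region :=
    (measurableSet_subgraph _ _ _ c.measurable_b).preimage
      ((continuous_coord c.e 0).prodMk (continuous_coord c.e 1)).measurable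
  rw [← (measurePreserving_chart c.e).setLIntegral_comp_preimage hm hF]
  congr 2
  ext p
  simp [region]

theorem poincare (c : LocalChart Ω U) : ∃ C : ℝ≥0∞, C ≠ ⊤ ∧ ∀ u : Plane → ℝ, ContDiff ℝ ∞ u → ∃ m : ℝ,
    ∫⁻ x in U ∩ Ω, ‖u x - m‖ₑ ^ 2 ≤ C * ∫⁻ x in Ω, ‖gradient u x‖ₑ ^ 2 := by
  obtain ⟨C, hC, h⟩ := poincare_subgraph c.e c.measurable_b c.s_lt c.t_lt c.le_b c.b_le
  refine ⟨C, hC, fun u hu => ?_⟩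
  obtain ⟨m, hm⟩ := h u hu
  refine ⟨m, (lintegral_mono_set c.inter_subset_region).trans ?_⟩
  rw [c.lintegral_region (F := fun x => ‖u x - m‖ₑ ^ 2)
    ((hu.continuous.sub continuous_const).enorm.measurable.pow_const 2)]
  refine hm.trans ?_
  rw [← c.lintegral_region (F := fun x => ‖gradient u x‖ₑ ^ 2)
    ((continuous_gradient hu).enorm.measurable.pow_const 2)]
  gcongr
  exact c.region_subset

/-- The parametrization of the graph. -/
def graphMap (s : ℝ) : Plane := chart c.e (s, c.b s)

theorem lipschitz_graphMap : LipschitzWith (1 + c.K) c.graphMap := by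
  refine LipschitzWith.of_dist_le_mul fun s t => ?_
  rw [dist_eq_norm, graphMap, graphMap, chart_sub]
  refine (norm_chart_le _ _).trans ?_
  have := c.lipschitz.dist_le_mul s t
  rw [Real.dist_eq, Real.dist_eq] at *
  simp only [Prod.mk_sub_mk]
  push_cast
  linarith

/-- The boundary in `U` is covered by the image of a `(1 + K)`-Lipschitz map of an interval, and
such a map enlarges lengths by at most this factor. For the trace inequality an upper bound is
enough, so no area formula enters. -/
theorem restrict_hausdorff_le :
    (μH[1] : Measure Plane).restrict (U ∩ frontier Ω) ≤
      ((1 + c.K : ℝ≥0) : ℝ≥0∞) • (volume.restrict (Set.Ioo c.s₁ c.s₂)).map c.graphMap := by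
  have hγ := c.lipschitz_graphMap.continuous.measurable
  refine Measure.le_iff.2 fun A hA => ?_
  rw [Measure.restrict_apply hA, Measure.smul_apply, Measure.map_apply hγ hA,
    Measure.restrict_apply (hγ hA), smul_eq_mul]
  calc μH[1] (A ∩ (U ∩ frontier Ω)) ≤
        μH[1] (c.graphMap '' (c.graphMap ⁻¹' A ∩ Set.Ioo c.s₁ c.s₂)) := by
        refine measure_mono fun x hx => ?_
        have hg : c.graphMap ((c.e x) 0) = x := by
          rw [graphMap, ← c.snd_eq_of_frontier x hx.2, chart_apply]
        refine ⟨(c.e x) 0, ⟨?_, c.fst_mem_of_frontier x hx.2⟩, hg⟩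
        rw [Set.mem_preimage, hg]
        exact hx.1
    _ ≤ _ := by
        have := c.lipschitz_graphMap.hausdorffMeasure_image_le zero_le_one
          (c.graphMap ⁻¹' A ∩ Set.Ioo c.s₁ c.s₂)
        rw [hausdorffMeasure_real] at this
        simpa using this

theorem trace_le (c : LocalChart Ω U) : ∃ C : ℝ≥0∞, C ≠ ⊤ ∧ ∀ u : Plane → ℝ, ContDiff ℝ ∞ u →
    ∫⁻ x in U ∩ frontier Ω, ‖u x‖ₑ ^ 2 ∂μH[1] ≤
      C * ((∫⁻ x in Ω, ‖u x‖ₑ ^ 2) + ∫⁻ x in Ω, ‖gradient u x‖ₑ ^ 2) := by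
  obtain ⟨C, hC, h⟩ := trace_subgraph c.e c.measurable_b c.t_lt c.le_b c.b_le
  refine ⟨((1 + c.K : ℝ≥0) : ℝ≥0∞) * C, by finiteness, fun u hu => ?_⟩
  have hmu : Measurable fun x => ‖u x‖ₑ ^ 2 := hu.continuous.enorm.measurable.pow_const 2
  refine (lintegral_mono' c.restrict_hausdorff_le le_rfl).trans ?_
  rw [lintegral_smul_measure, lintegral_map hmu c.lipschitz_graphMap.continuous.measurable,
    smul_eq_mul, mul_assoc]
  gcongr
  refine (h u hu).trans ?_
  rw [← c.lintegral_region (F := fun x => ‖gradient u x‖ₑ ^ 2)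
    ((continuous_gradient hu).enorm.measurable.pow_const 2), ← c.lintegral_region hmu]
  gcongr
  · exact c.region_subset
  · exact c.region_subset

end LocalChart

/-! ### The trace and Poincaré inequalities for smooth functions -/

/-- Compactness of the boundary: the estimate holds near each boundary point and is stable under
subsets and finite unions. -/
theorem exists_trace_le {Ω : Set Plane} (ho : IsOpen Ω) (hb : Bornology.IsBounded Ω)
    (hl : HasLipschitzBoundary Ω) : ∃ C : ℝ≥0∞, C ≠ ⊤ ∧ ∀ u : Plane → ℝ, ContDiff ℝ ∞ u →
      ∫⁻ x in frontier Ω, ‖u x‖ₑ ^ 2 ∂μH[1] ≤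
        C * ((∫⁻ x in Ω, ‖u x‖ₑ ^ 2) + ∫⁻ x in Ω, ‖gradient u x‖ₑ ^ 2) := by
  have hK : IsCompact (frontier Ω) :=
    hb.isCompact_closure.of_isClosed_subset isClosed_frontier frontier_subset_closure
  refine hK.induction_on (p := fun S => ∃ C : ℝ≥0∞, C ≠ ⊤ ∧ ∀ u : Plane → ℝ, ContDiff ℝ ∞ u →
      ∫⁻ x in S, ‖u x‖ₑ ^ 2 ∂μH[1] ≤
        C * ((∫⁻ x in Ω, ‖u x‖ₑ ^ 2) + ∫⁻ x in Ω, ‖gradient u x‖ₑ ^ 2)) ?_ ?_ ?_ ?_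
  · exact ⟨0, by simp, fun u _ => by simp⟩
  · rintro S T hST ⟨C, hC, h⟩
    exact ⟨C, hC, fun u hu => (lintegral_mono_set hST).trans (h u hu)⟩
  · rintro S T ⟨C, hC, h⟩ ⟨C', hC', h'⟩
    refine ⟨C + C', by finiteness, fun u hu => (lintegral_union_le _ _ _).trans ?_⟩
    rw [add_mul]
    exact add_le_add (h u hu) (h' u hu)
  · intro p hp
    obtain ⟨U, hU, hpU, ⟨c⟩⟩ := exists_localChart ho hl (frontier_subset_closure hp)
    refine ⟨U ∩ frontier Ω, ?_, c.trace_le⟩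
    rw [Set.inter_comm]
    exact inter_mem_nhdsWithin _ (hU.mem_nhds hpU)

/-- On `S` the smooth functions are controlled, up to a constant, by their gradient in `Ω`. -/
def PoincareOn (Ω S : Set Plane) : Prop :=
  ∃ C : ℝ≥0∞, C ≠ ⊤ ∧ ∀ u : Plane → ℝ, ContDiff ℝ ∞ u → ∃ m : ℝ,
    ∫⁻ x in S, ‖u x - m‖ₑ ^ 2 ≤ C * ∫⁻ x in Ω, ‖gradient u x‖ₑ ^ 2

theorem PoincareOn.mono {Ω S T : Set Plane} (h : PoincareOn Ω T) (hST : S ⊆ T) :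
    PoincareOn Ω S := by
  obtain ⟨C, hC, h⟩ := h
  refine ⟨C, hC, fun u hu => ?_⟩
  obtain ⟨m, hm⟩ := h u hu
  exact ⟨m, (lintegral_mono_set hST).trans hm⟩

/-- On the overlap `u` is close to both `m` and `m'`. Since the overlap has positive measure, `m' -
m` is bounded by the energy, so `m` can replace `m'` on `T`. -/
theorem PoincareOn.union {Ω S T : Set Plane} (hS : PoincareOn Ω S) (hT : PoincareOn Ω T)
    (h0 : volume (S ∩ T) ≠ 0) (hTfin : volume T ≠ ⊤) : PoincareOn Ω (S ∪ T) := by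
  obtain ⟨C, hC, h⟩ := hS
  obtain ⟨C', hC', h'⟩ := hT
  set V := volume (S ∩ T) with hV
  have hVt : V ≠ ⊤ := measure_ne_top_of_subset Set.inter_subset_right hTfin
  have hVi : V⁻¹ ≠ ⊤ := ENNReal.inv_ne_top.2 h0
  refine ⟨C + (2 * C' + 2 * (volume T * (V⁻¹ * (2 * C + 2 * C')))), by finiteness, fun u hu => ?_⟩
  obtain ⟨m, hm⟩ := h u hu
  obtain ⟨m', hm'⟩ := h' u hu
  refine ⟨m, ?_⟩
  set E := ∫⁻ x in Ω, ‖gradient u x‖ₑ ^ 2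
  have hmeas : ∀ k : ℝ, Measurable fun x => ‖u x - k‖ₑ ^ 2 := fun k =>
    (hu.continuous.sub continuous_const).enorm.measurable.pow_const 2
  have hmm : ‖m' - m‖ₑ ^ 2 ≤ V⁻¹ * ((2 * C + 2 * C') * E) := by
    have h1 : ∫⁻ _ in S ∩ T, ‖m' - m‖ₑ ^ 2 ≤ (2 * C + 2 * C') * E := by
      calc ∫⁻ _ in S ∩ T, ‖m' - m‖ₑ ^ 2
          ≤ ∫⁻ x in S ∩ T, (2 * ‖u x - m‖ₑ ^ 2 + 2 * ‖u x - m'‖ₑ ^ 2) := by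
            refine lintegral_mono fun x => ?_
            have := enorm_add_sq_le (u x - m) (-(u x - m'))
            rw [enorm_neg] at this
            convert this using 3
            ring
        _ = 2 * (∫⁻ x in S ∩ T, ‖u x - m‖ₑ ^ 2) + 2 * ∫⁻ x in S ∩ T, ‖u x - m'‖ₑ ^ 2 := by
            rw [lintegral_add_left ((hmeas m).const_mul 2), lintegral_const_mul _ (hmeas m),
              lintegral_const_mul _ (hmeas m')]
        _ ≤ 2 * (C * E) + 2 * (C' * E) := by
            gcongr
            · exact (lintegral_mono_set Set.inter_subset_left).trans hm
            · exact (lintegral_mono_set Set.inter_subset_right).trans hm'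
        _ = _ := by ring
    rw [setLIntegral_const] at h1
    calc ‖m' - m‖ₑ ^ 2 = V⁻¹ * (‖m' - m‖ₑ ^ 2 * V) := by
          rw [mul_comm _ V, ← mul_assoc, ENNReal.inv_mul_cancel h0 hVt, one_mul]
      _ ≤ _ := by gcongr
  have hTm : ∫⁻ x in T, ‖u x - m‖ₑ ^ 2 ≤
      2 * (C' * E) + 2 * (V⁻¹ * ((2 * C + 2 * C') * E) * volume T) := by
    calc ∫⁻ x in T, ‖u x - m‖ₑ ^ 2
        ≤ ∫⁻ x in T, (2 * ‖u x - m'‖ₑ ^ 2 + 2 * ‖m' - m‖ₑ ^ 2) := by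
          refine lintegral_mono fun x => ?_
          have := enorm_add_sq_le (u x - m') (m' - m)
          rwa [sub_add_sub_cancel] at this
      _ = 2 * (∫⁻ x in T, ‖u x - m'‖ₑ ^ 2) + 2 * (‖m' - m‖ₑ ^ 2 * volume T) := by
          rw [lintegral_add_right _ measurable_const, lintegral_const_mul _ (hmeas m'),
            setLIntegral_const, mul_assoc]
      _ ≤ _ := by gcongr
  refine (lintegral_union_le _ _ _).trans ((add_le_add hm hTm).trans_eq ?_)
  ring

/-- `Ω` is covered by finitely many charts, and overlapping pieces can be glued because a nonempty
open overlap has positive measure. A maximal glued family meets none of the remaining pieces inside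
`Ω`, so by connectedness it covers `Ω`. -/
theorem poincareOn_self {Ω : Set Plane} (ho : IsOpen Ω) (hc : IsConnected Ω)
    (hb : Bornology.IsBounded Ω) (hl : HasLipschitzBoundary Ω) : PoincareOn Ω Ω := by
  classical
  have hloc : ∀ p ∈ closure Ω, ∃ U, IsOpen U ∧ p ∈ U ∧ PoincareOn Ω (U ∩ Ω) := fun p hp => by
    obtain ⟨U, hU, hpU, ⟨c⟩⟩ := exists_localChart ho hl hp
    exact ⟨U, hU, hpU, c.poincare⟩
  choose! U hU hpU hP using hloc
  obtain ⟨s, hs, hcov⟩ := hb.isCompact_closure.elim_nhds_subcover U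
    (fun p hp => (hU p hp).mem_nhds (hpU p hp))
  have hfin : ∀ A : Set Plane, volume (A ∩ Ω) ≠ ⊤ := fun A =>
    measure_ne_top_of_subset Set.inter_subset_right hb.measure_lt_top.ne
  have hcovΩ : Ω ⊆ ⋃ p ∈ s, U p := subset_closure.trans hcov
  -- a largest part of the cover on which the inequality holds and which meets `Ω`
  let good : Finset (Finset Plane) := s.powerset.filter fun J =>
    PoincareOn Ω ((⋃ p ∈ J, U p) ∩ Ω) ∧ ((⋃ p ∈ J, U p) ∩ Ω).Nonempty
  have hgood : good.Nonempty := by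
    obtain ⟨x, hx⟩ := hc.nonempty
    obtain ⟨p, hp, hxp⟩ := Set.mem_iUnion₂.1 (hcovΩ hx)
    refine ⟨{p}, ?_⟩
    simp only [good, Finset.mem_filter, Finset.mem_powerset, Finset.singleton_subset_iff,
      Finset.mem_singleton, Set.iUnion_iUnion_eq_left]
    exact ⟨hp, hP p (hs p hp), x, hxp, hx⟩
  obtain ⟨J, hJ, hmax⟩ := good.exists_max_image Finset.card hgood
  obtain ⟨hJs, hJP, hJne⟩ := by simpa [good] using hJ
  set A := ⋃ p ∈ J, U p with hA
  have hAo : IsOpen A := isOpen_biUnion fun p hp => hU p (hs p (hJs hp))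
  -- A remaining piece that overlaps `A` inside `Ω` could be added to `J`, against maximality.
  have hdisj : ∀ p ∈ s, p ∉ J → ¬ (A ∩ Ω ∩ (U p ∩ Ω)).Nonempty := by
    intro p hp hpJ hne
    have hopen : IsOpen (A ∩ Ω ∩ (U p ∩ Ω)) :=
      (hAo.inter ho).inter ((hU p (hs p hp)).inter ho)
    have hun := hJP.union (hP p (hs p hp)) (hopen.measure_pos volume hne).ne' (hfin _)
    have hins : insert p J ∈ good := by
      simp only [good, Finset.mem_filter, Finset.mem_powerset]
      have heq : (⋃ q ∈ insert p J, U q) ∩ Ω = A ∩ Ω ∪ U p ∩ Ω := by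
        rw [Finset.set_biUnion_insert, Set.union_inter_distrib_right, Set.union_comm]
      rw [heq]
      exact ⟨Finset.insert_subset hp hJs, hun, hJne.mono Set.subset_union_left⟩
    have := hmax _ hins
    rw [Finset.card_insert_of_notMem hpJ] at this
    omega
  set A' := ⋃ p ∈ s \ J, U p with hA'
  have hA'o : IsOpen A' := isOpen_biUnion fun p hp => hU p (hs p (Finset.mem_sdiff.1 hp).1)
  have hΩA : Ω ⊆ A := by
    intro x hx
    by_contra hxA
    have hcov' : Ω ⊆ A ∪ A' := by
      intro y hy
      obtain ⟨p, hp, hyp⟩ := Set.mem_iUnion₂.1 (hcovΩ hy)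
      by_cases hpJ : p ∈ J
      · exact Or.inl (Set.mem_iUnion₂.2 ⟨p, hpJ, hyp⟩)
      · exact Or.inr (Set.mem_iUnion₂.2 ⟨p, Finset.mem_sdiff.2 ⟨hp, hpJ⟩, hyp⟩)
    obtain ⟨y, hyΩ, hyA, hyA'⟩ := hc.isPreconnected A A' hAo hA'o hcov'
      (by rwa [Set.inter_comm] at hJne) ⟨x, hx, (hcov' hx).resolve_left hxA⟩
    obtain ⟨p, hp, hyp⟩ := Set.mem_iUnion₂.1 hyA'
    obtain ⟨hps, hpJ⟩ := Finset.mem_sdiff.1 hp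
    exact hdisj p hps hpJ ⟨y, ⟨hyA, hyΩ⟩, hyp, hyΩ⟩
  exact hJP.mono fun x hx => ⟨hΩA hx, hx⟩

end Graetz
end

/-! ### Weak gradients, traces and the closed space of admissible triples -/

noncomputable section

namespace Graetz

theorem inner_gradient_eq_fderiv (u : Plane → ℝ) (x e : Plane) :
    inner ℝ (gradient u x) e = fderiv ℝ u x e := by
  rw [gradient, InnerProductSpace.toDual_symm_apply]

theorem gradient_add_of_contDiff {u v : Plane → ℝ} (hu : ContDiff ℝ ∞ u) (hv : ContDiff ℝ ∞ v)
    (x : Plane) : gradient (u + v) x = gradient u x + gradient v x := by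
  unfold gradient
  rw [fderiv_add (hu.differentiable (by simp)).differentiableAt
    (hv.differentiable (by simp)).differentiableAt, map_add]

theorem gradient_const_smul_of_contDiff {u : Plane → ℝ} (hu : ContDiff ℝ ∞ u) (k : ℝ)
    (x : Plane) : gradient (k • u) x = k • gradient u x := by
  unfold gradient
  rw [fderiv_const_smul (hu.differentiable (by simp)).differentiableAt, map_smulₛₗ]
  simp

theorem enorm_sq_eq_lintegral {α E : Type*} [MeasurableSpace α] [NormedAddCommGroup E]
    {μ : Measure α} {f : Lp E 2 μ} {g : α → E} (h : f =ᵐ[μ] g) :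
    ‖f‖ₑ ^ 2 = ∫⁻ x, ‖g x‖ₑ ^ 2 ∂μ := by
  have := eLpNorm_nnreal_pow_eq_lintegral (μ := μ) (f := g) (p := 2) two_ne_zero
  rw [Lp.enorm_def, eLpNorm_congr_ae h]
  simpa using this

theorem norm_sq_le_of_enorm_sq_le {E F : Type*} [NormedAddCommGroup E] [NormedAddCommGroup F]
    {x : E} {y : F} {C : ℝ≥0∞} (hC : C ≠ ⊤) (h : ‖x‖ₑ ^ 2 ≤ C * ‖y‖ₑ ^ 2) :
    ‖x‖ ^ 2 ≤ C.toReal * ‖y‖ ^ 2 := by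
  have := ENNReal.toReal_mono (by finiteness) h
  simpa using this

theorem memLp_of_continuous {α E : Type*} [TopologicalSpace α] [MeasurableSpace α]
    [OpensMeasurableSpace α] [SecondCountableTopology α] [TopologicalSpace.PseudoMetrizableSpace α]
    [NormedAddCommGroup E] {S K : Set α} {μ : Measure α} [IsFiniteMeasure (μ.restrict S)]
    (hK : IsCompact K) (hSK : S ⊆ K) (hS : MeasurableSet S) {f : α → E} (hf : Continuous f)
    (p : ℝ≥0∞) : MemLp f p (μ.restrict S) := by
  obtain ⟨C, hC⟩ := hK.exists_bound_of_continuousOn hf.continuousOn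
  refine MemLp.of_bound hf.aestronglyMeasurable C ?_
  filter_upwards [ae_restrict_mem hS] with x hx using hC x (hSK hx)

theorem integral_mul_fderiv_eq_of_tsupport_subset {Ω : Set Plane} {u φ : Plane → ℝ}
    (hu : ContDiff ℝ ∞ u) (hφ : ContDiff ℝ ∞ φ) (hc : HasCompactSupport φ) (hs : tsupport φ ⊆ Ω)
    (e : Plane) :
    ∫ x in Ω, u x * fderiv ℝ φ x e = - ∫ x in Ω, inner ℝ (gradient u x) e * φ x := by
  have hd : Continuous fun x => fderiv ℝ φ x e :=
    (hφ.continuous_fderiv (by simp)).clm_apply continuous_const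
  have hdu : Continuous fun x => fderiv ℝ u x e :=
    (hu.continuous_fderiv (by simp)).clm_apply continuous_const
  have hcd : HasCompactSupport fun x => fderiv ℝ φ x e := hc.fderiv_apply ℝ e
  have hz : ∀ x, x ∉ Ω → φ x = 0 := fun x hx => image_eq_zero_of_notMem_tsupport fun h => hx (hs h)
  have hdz : ∀ x, x ∉ Ω → fderiv ℝ φ x e = 0 := fun x hx => by
    have : fderiv ℝ φ x = 0 :=
      Function.notMem_support.1 fun h => hx (hs (support_fderiv_subset ℝ h))
    rw [this]; rfl
  simp_rw [inner_gradient_eq_fderiv]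
  rw [setIntegral_eq_integral_of_forall_compl_eq_zero fun x hx => by rw [hdz x hx, mul_zero],
    setIntegral_eq_integral_of_forall_compl_eq_zero fun x hx => by rw [hz x hx, mul_zero]]
  exact integral_mul_fderiv_eq_neg_fderiv_mul_of_integrable
    ((hdu.mul hφ.continuous).integrable_of_hasCompactSupport hc.mul_left)
    ((hu.continuous.mul hd).integrable_of_hasCompactSupport hcd.mul_left)
    ((hu.continuous.mul hφ.continuous).integrable_of_hasCompactSupport hc.mul_left)
    (fun x _ => (hu.differentiable (by simp)).differentiableAt)
    (fun x _ => (hφ.differentiable (by simp)).differentiableAt)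

/-- Each coordinate of the difference is orthogonal to all test functions. This lets the identity
for `∫ (c - h w)` be stated with any weak gradient of `w`. -/
theorem IsWeakGradient.ae_eq {Ω : Set Plane} (ho : IsOpen Ω) {u : Plane → ℝ} {G G' : Plane → Plane}
    (h : IsWeakGradient Ω u G) (h' : IsWeakGradient Ω u G') : G =ᵐ[volume.restrict Ω] G' := by
  have key : ∀ i : Fin 2, ∀ᵐ x ∂(volume.restrict Ω),
      inner ℝ (G x - G' x) (EuclideanSpace.single i 1) = 0 := by
    intro i
    set e : Plane := EuclideanSpace.single i 1
    have hm : MemLp (fun x => inner ℝ (G x) e) 2 (volume.restrict Ω) := h.memLp_grad.inner_const e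
    have hm' : MemLp (fun x => inner ℝ (G' x) e) 2 (volume.restrict Ω) :=
      h'.memLp_grad.inner_const e
    rw [ae_restrict_iff' ho.measurableSet]
    refine ho.ae_eq_zero_of_integral_contDiff_smul_eq_zero ?_ fun g hg hgc hgs => ?_
    · refine locallyIntegrableOn_of_locallyIntegrable_restrict ?_
      refine MemLp.locallyIntegrable (p := 2) ?_ (by norm_num)
      exact (h.memLp_grad.sub h'.memLp_grad).inner_const e
    · have h1 := h.integral_eq g hg hgc hgs e
      rw [h'.integral_eq g hg hgc hgs e, neg_inj] at h1
      have hgL : MemLp g 2 (volume.restrict Ω) :=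
        (hg.continuous.memLp_of_hasCompactSupport hgc).restrict Ω
      have hz : ∀ x, x ∉ Ω → g x • inner ℝ (G x - G' x) e = 0 := fun x hx => by
        rw [image_eq_zero_of_notMem_tsupport fun h => hx (hgs h), zero_smul]
      rw [← setIntegral_eq_integral_of_forall_compl_eq_zero hz]
      have : ∀ x, g x • inner ℝ (G x - G' x) e =
          inner ℝ (G x) e * g x - inner ℝ (G' x) e * g x := fun x => by
        rw [inner_sub_left, smul_eq_mul]; ring
      simp_rw [this]
      have hsub := integral_sub (hm.integrable_mul hgL) (hm'.integrable_mul hgL)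
      simp only [Pi.mul_apply] at hsub
      rw [hsub, h1, sub_self]
  filter_upwards [key 0, key 1] with x h0 h1
  ext i
  fin_cases i
  · simpa [sub_eq_zero, EuclideanSpace.inner_single_right] using h0
  · simpa [sub_eq_zero, EuclideanSpace.inner_single_right] using h1

namespace Setting

variable (D : Setting)

theorem isCompact_frontier : IsCompact (frontier D.Ω) :=
  D.isBounded.isCompact_closure.of_isClosed_subset isClosed_frontier frontier_subset_closure

/-- The trace inequality for the constant function `1` bounds the length of the boundary. -/
instance : IsFiniteMeasure (bdryMeasure D.Ω) := by
  obtain ⟨C, hC, h⟩ := exists_trace_le D.isOpen D.isBounded D.lipschitz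
  have h1 := h (fun _ => 1) contDiff_const
  refine ⟨?_⟩
  have hfin := measure_lt_top (volume.restrict D.Ω) Set.univ
  simp [gradient] at h1 hfin ⊢
  exact h1.trans_lt (ENNReal.mul_lt_top hC.lt_top hfin)

theorem memLp_of_continuous {E : Type*} [NormedAddCommGroup E] {f : Plane → E} (hf : Continuous f)
    (p : ℝ≥0∞) : MemLp f p (volume.restrict D.Ω) :=
  Graetz.memLp_of_continuous D.isBounded.isCompact_closure subset_closure D.isOpen.measurableSet
    hf p

theorem memLp_bdry_of_continuous {E : Type*} [NormedAddCommGroup E] {f : Plane → E}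
    (hf : Continuous f) (p : ℝ≥0∞) : MemLp f p (bdryMeasure D.Ω) :=
  Graetz.memLp_of_continuous D.isCompact_frontier le_rfl isClosed_frontier.measurableSet hf p

/-- A function, its gradient and its boundary values. -/
abbrev Triple : Type := D.L2 × D.L2vec × D.L2bdry

/-- The triples that come from smooth functions. -/
def smooth : Submodule ℝ D.Triple where
  carrier := {x | ∃ u : Plane → ℝ, ContDiff ℝ ∞ u ∧ x.1 =ᵐ[volume.restrict D.Ω] u ∧
    x.2.1 =ᵐ[volume.restrict D.Ω] gradient u ∧ x.2.2 =ᵐ[bdryMeasure D.Ω] u}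
  add_mem' := by
    rintro x y ⟨u, hu, h1, h2, h3⟩ ⟨v, hv, k1, k2, k3⟩
    refine ⟨u + v, hu.add hv, (Lp.coeFn_add _ _).trans (h1.add k1), ?_,
      (Lp.coeFn_add _ _).trans (h3.add k3)⟩
    refine (Lp.coeFn_add _ _).trans ((h2.add k2).trans (Eventually.of_forall fun x => ?_))
    exact (gradient_add_of_contDiff hu hv x).symm
  zero_mem' := ⟨0, contDiff_const, Lp.coeFn_zero _ _ _,
    (Lp.coeFn_zero _ _ _).trans (Eventually.of_forall fun x => by
      simp [gradient]), Lp.coeFn_zero _ _ _⟩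
  smul_mem' := by
    rintro k x ⟨u, hu, h1, h2, h3⟩
    refine ⟨k • u, hu.const_smul k, (Lp.coeFn_smul _ _).trans (h1.const_smul k), ?_,
      (Lp.coeFn_smul _ _).trans (h3.const_smul k)⟩
    refine (Lp.coeFn_smul _ _).trans ((h2.const_smul k).trans (Eventually.of_forall fun x => ?_))
    exact (gradient_const_smul_of_contDiff hu k x).symm

variable {D}

theorem tendsto_eLpNorm_iff {E : Type*} [NormedAddCommGroup E] {μ : Measure Plane}
    {f : ℕ → Plane → E} {F : ℕ → Lp E 2 μ} (h : ∀ n, F n =ᵐ[μ] f n) (g : Lp E 2 μ) :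
    Tendsto (fun n => eLpNorm (fun x => f n x - g x) 2 μ) atTop (𝓝 0) ↔
      Tendsto F atTop (𝓝 g) := by
  rw [Lp.tendsto_Lp_iff_tendsto_eLpNorm']
  refine tendsto_congr fun n => eLpNorm_congr_ae ?_
  filter_upwards [h n] with x hx
  simp [hx]

/-- The three limits in `HasTrace` say that smooth triples converge in the product of the `L²`
spaces. Having a trace is thus a closed linear condition on the triple. -/
theorem hasTrace_iff {x : D.Triple} :
    HasTrace D.Ω x.1 x.2.1 x.2.2 ↔ x ∈ D.smooth.topologicalClosure := by
  rw [← SetLike.mem_coe, Submodule.topologicalClosure_coe, mem_closure_iff_seq_limit]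
  constructor
  · rintro ⟨φ, hφ, h1, h2, h3⟩
    have m1 := fun n => D.memLp_of_continuous (hφ n).continuous 2
    have m2 := fun n => D.memLp_of_continuous (continuous_gradient (hφ n)) 2
    have m3 := fun n => D.memLp_bdry_of_continuous (hφ n).continuous 2
    refine ⟨fun n => ((m1 n).toLp _, (m2 n).toLp _, (m3 n).toLp _), fun n =>
      ⟨φ n, hφ n, (m1 n).coeFn_toLp, (m2 n).coeFn_toLp, (m3 n).coeFn_toLp⟩, ?_⟩
    refine Tendsto.prodMk_nhds ?_ (Tendsto.prodMk_nhds ?_ ?_)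
    · exact (tendsto_eLpNorm_iff (fun n => (m1 n).coeFn_toLp) _).1 h1
    · exact (tendsto_eLpNorm_iff (fun n => (m2 n).coeFn_toLp) _).1 h2
    · exact (tendsto_eLpNorm_iff (fun n => (m3 n).coeFn_toLp) _).1 h3
  · rintro ⟨y, hy, hlim⟩
    choose φ hφ h1 h2 h3 using hy
    refine ⟨φ, hφ, ?_, ?_, ?_⟩
    · exact (tendsto_eLpNorm_iff h1 _).2 ((continuous_fst.tendsto _).comp hlim)
    · exact (tendsto_eLpNorm_iff h2 _).2
        (((continuous_fst.comp continuous_snd).tendsto _).comp hlim)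
    · exact (tendsto_eLpNorm_iff h3 _).2
        (((continuous_snd.comp continuous_snd).tendsto _).comp hlim)

/-- Against a fixed test function, integration by parts is an equality of continuous functionals of
the triple; it holds for smooth functions and passes to limits. -/
theorem isWeakGradient_of_mem_closure {x : D.Triple} (hx : x ∈ D.smooth.topologicalClosure) :
    IsWeakGradient D.Ω x.1 x.2.1 := by
  refine ⟨Lp.memLp _, Lp.memLp _, fun φ hφ hc hs e => ?_⟩
  have hd : Continuous fun x => fderiv ℝ φ x e :=
    (hφ.continuous_fderiv (by simp)).clm_apply continuous_const
  have he : Continuous fun x => φ x • e := hφ.continuous.smul continuous_const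
  have m1 := D.memLp_of_continuous hd 2
  have m2 := D.memLp_of_continuous he 2
  have e1 : ∀ s : D.L2, inner ℝ (m1.toLp _) s = ∫ x in D.Ω, s x * fderiv ℝ φ x e := fun s => by
    rw [L2.inner_def]
    refine integral_congr_ae ?_
    filter_upwards [m1.coeFn_toLp] with x hx
    rw [hx]; simp
  have e2 : ∀ G : D.L2vec, inner ℝ (m2.toLp _) G = ∫ x in D.Ω, inner ℝ (G x) e * φ x := fun G => by
    rw [L2.inner_def]
    refine integral_congr_ae ?_
    filter_upwards [m2.coeFn_toLp] with x hx
    rw [hx, real_inner_smul_left, real_inner_comm, mul_comm]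
  have hclosed : IsClosed {y : D.Triple | inner ℝ (m1.toLp _) y.1 = -inner ℝ (m2.toLp _) y.2.1} :=
    isClosed_eq (by fun_prop) (by fun_prop)
  have hsub : (D.smooth : Set D.Triple) ⊆
      {y : D.Triple | inner ℝ (m1.toLp _) y.1 = -inner ℝ (m2.toLp _) y.2.1} := by
    rintro y ⟨u, hu, h1, h2, -⟩
    rw [Set.mem_ofPred_eq, e1, e2]
    have := integral_mul_fderiv_eq_of_tsupport_subset hu hφ hc hs e
    rw [integral_congr_ae (g := fun x => u x * fderiv ℝ φ x e)
      (by filter_upwards [h1] with x hx; rw [hx]), this, neg_inj]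
    refine integral_congr_ae ?_
    filter_upwards [h2] with x hx
    rw [hx]
  have := closure_minimal hsub hclosed hx
  rwa [Set.mem_ofPred_eq, e1, e2] at this

/-! ### The boundary conditions -/

theorem ΓD_subset : D.ΓD ⊆ frontier D.Ω := by
  rw [← D.cover]; intro x hx; simp [hx]

theorem ΓR_subset : D.ΓR ⊆ frontier D.Ω := by
  rw [← D.cover]; intro x hx; simp [hx]

theorem perPart_subset (k : Fin D.numPer) : D.perPart k ⊆ frontier D.Ω := by
  rw [← D.cover, D.Γper_eq]
  exact fun x hx => Or.inr (Set.mem_iUnion.2 ⟨k, Or.inl hx⟩)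

theorem shift_mem_frontier {k : Fin D.numPer} {x : Plane} (hx : x ∈ D.perPart k) :
    D.perShift k + x ∈ frontier D.Ω := by
  rw [← D.cover, D.Γper_eq]
  exact Or.inr (Set.mem_iUnion.2 ⟨k, Or.inr ⟨x, hx, rfl⟩⟩)

theorem ae_restrict_of_ae_bdry {S : Set Plane} (hS : S ⊆ frontier D.Ω) {p : Plane → Prop}
    (h : ∀ᵐ x ∂(bdryMeasure D.Ω), p x) : ∀ᵐ x ∂((μH[1]).restrict S), p x :=
  ae_mono (Measure.restrict_mono hS le_rfl) h

/-- Translations are isometries and therefore preserve null sets for arc length. -/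
theorem ae_shift (k : Fin D.numPer) {p : Plane → Prop} (h : ∀ᵐ x ∂(bdryMeasure D.Ω), p x) :
    ∀ᵐ x ∂((μH[1]).restrict (D.perPart k)), p (D.perShift k + x) := by
  rw [ae_iff, Measure.restrict_apply' isClosed_frontier.measurableSet] at h
  rw [ae_iff, Measure.restrict_apply' (D.measurable_perPart k)]
  refine measure_mono_null (fun x hx => ?_)
    (((IsometryEquiv.addLeft (D.perShift k)).hausdorffMeasure_preimage 1 _).trans h)
  exact ⟨hx.1, shift_mem_frontier hx.2⟩

variable (D) in
/-- The boundary values that vanish on `ΓD` and are periodic on `Γper`. -/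
def bdryValues : Submodule ℝ D.L2bdry where
  carrier := {g | (∀ᵐ x ∂((μH[1]).restrict D.ΓD), g x = 0) ∧
    ∀ k, ∀ᵐ x ∂((μH[1]).restrict (D.perPart k)), g (D.perShift k + x) = g x}
  add_mem' := by
    rintro g g' ⟨h1, h2⟩ ⟨h1', h2'⟩
    have hadd := Lp.coeFn_add g g'
    refine ⟨?_, fun k => ?_⟩
    · filter_upwards [h1, h1', ae_restrict_of_ae_bdry ΓD_subset hadd] with x a b c
      rw [c, Pi.add_apply, a, b, add_zero]
    · filter_upwards [h2 k, h2' k, ae_restrict_of_ae_bdry (perPart_subset k) hadd,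
        ae_shift k hadd] with x a b c d
      rw [c, d, Pi.add_apply, Pi.add_apply, a, b]
  zero_mem' := by
    have h0 := Lp.coeFn_zero ℝ 2 (bdryMeasure D.Ω)
    refine ⟨ae_restrict_of_ae_bdry ΓD_subset h0, fun k => ?_⟩
    filter_upwards [ae_restrict_of_ae_bdry (perPart_subset k) h0, ae_shift k h0] with x a b
    rw [a, b]; rfl
  smul_mem' := by
    rintro r g ⟨h1, h2⟩
    have hsm := Lp.coeFn_smul r g
    refine ⟨?_, fun k => ?_⟩
    · filter_upwards [h1, ae_restrict_of_ae_bdry ΓD_subset hsm] with x a c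
      rw [c, Pi.smul_apply, a, smul_zero]
    · filter_upwards [h2 k, ae_restrict_of_ae_bdry (perPart_subset k) hsm, ae_shift k hsm]
        with x a c d
      rw [c, d, Pi.smul_apply, Pi.smul_apply, a]

/-- An `L²` limit is an almost everywhere limit along a subsequence, and this also holds at the
translated points. -/
theorem isClosed_bdryValues : IsClosed (D.bdryValues : Set D.L2bdry) := by
  refine IsSeqClosed.isClosed fun g g' hg hlim => ?_
  obtain ⟨ns, -, hns⟩ := (tendstoInMeasure_of_tendsto_Lp hlim).exists_seq_tendsto_ae
  refine ⟨?_, fun k => ?_⟩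
  · have h := ae_all_iff.2 fun n => (hg n).1
    filter_upwards [h, ae_restrict_of_ae_bdry ΓD_subset hns] with x hx hx'
    simp only [hx] at hx'
    exact (tendsto_nhds_unique hx' tendsto_const_nhds)
  · have h := ae_all_iff.2 fun n => (hg n).2 k
    filter_upwards [h, ae_restrict_of_ae_bdry (perPart_subset k) hns, ae_shift k hns]
      with x hx hx' hx''
    simp only [hx] at hx''
    exact tendsto_nhds_unique hx'' hx'

variable (D) in
/-- The space `V` of the admissible functions, with their gradients and traces. -/
def V : Submodule ℝ D.Triple :=
  D.smooth.topologicalClosure ⊓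
    D.bdryValues.comap (LinearMap.snd ℝ D.L2vec D.L2bdry ∘ₗ LinearMap.snd ℝ D.L2 _)

theorem mem_V_iff {x : D.Triple} : x ∈ D.V ↔ D.Admissible x.1 x.2.1 x.2.2 :=
  ⟨fun h => ⟨isWeakGradient_of_mem_closure h.1, hasTrace_iff.2 h.1, h.2.1, h.2.2⟩,
    fun h => ⟨hasTrace_iff.1 h.trace, h.dirichlet, h.periodic⟩⟩

theorem isClosed_V : IsClosed (D.V : Set D.Triple) :=
  D.smooth.isClosed_topologicalClosure.inter
    (isClosed_bdryValues.preimage (continuous_snd.comp continuous_snd))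

/-! ### Constants -/

variable (D) in
/-- The constant function `1`, with its gradient and its boundary values. -/
def one : D.Triple := (D.const 1, 0, Lp.const 2 (bdryMeasure D.Ω) 1)

theorem const_eq_smul (r : ℝ) : D.const r = r • D.const 1 := by
  have := (Lp.constₗ 2 (volume.restrict D.Ω) ℝ : ℝ →ₗ[ℝ] _).map_smul r (1 : ℝ)
  simpa [const] using this

theorem coeFn_const (r : ℝ) : D.const r =ᵐ[volume.restrict D.Ω] fun _ => r := Lp.coeFn_const _ _ _

theorem one_mem_smooth : D.one ∈ D.smooth :=
  ⟨fun _ => 1, contDiff_const, Lp.coeFn_const _ _ _,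
    (Lp.coeFn_zero _ _ _).trans (Eventually.of_forall fun x => by simp [gradient]),
    Lp.coeFn_const _ _ _⟩

/-- Here `ΓD` has length zero, so the Dirichlet condition is void, and constants are periodic. -/
theorem one_mem_V (h : ¬ D.ConstantsControlled) : D.one ∈ D.V := by
  have h1 : ∀ᵐ x ∂(bdryMeasure D.Ω), D.one.2.2 x = 1 := Lp.coeFn_const _ _ _
  refine ⟨D.smooth.le_topologicalClosure one_mem_smooth, ?_, fun k => ?_⟩
  · have : (μH[1] : Measure Plane).restrict D.ΓD = 0 := by
      rw [Measure.restrict_eq_zero]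
      exact measure_mono_null Set.subset_union_left (not_not.1 h)
    rw [this]; simp
  · filter_upwards [ae_restrict_of_ae_bdry (perPart_subset k) h1, ae_shift k h1] with x a b
    exact b.trans a.symm

end Setting
end Graetz
end

noncomputable section

namespace Graetz

/-! ### Multiplication by bounded functions -/

section Multiplication

variable {α E : Type*} [MeasurableSpace α] {μ : Measure α} [NormedAddCommGroup E]
  [InnerProductSpace ℝ E]

/-- Multiplication by a bounded function, as an operator on `L²`. -/
def mulL2 {a : α → ℝ} (ha : MemLp a ⊤ μ) : Lp E 2 μ →L[ℝ] Lp E 2 μ :=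
  (ContinuousLinearMap.lsmul ℝ ℝ).holderL μ ⊤ 2 2 (ha.toLp a)

theorem coeFn_mulL2 {a : α → ℝ} (ha : MemLp a ⊤ μ) (f : Lp E 2 μ) :
    mulL2 ha f =ᵐ[μ] fun x => a x • f x := by
  refine ((ContinuousLinearMap.lsmul ℝ ℝ : ℝ →L[ℝ] E →L[ℝ] E).coeFn_holder
    (r := 2) (ha.toLp a) f).trans ?_
  filter_upwards [ha.coeFn_toLp] with x hx
  simp [hx]

theorem inner_mulL2 {a : α → ℝ} (ha : MemLp a ⊤ μ) (f g : Lp E 2 μ) :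
    inner ℝ (mulL2 ha f) g = ∫ x, a x * inner ℝ (f x) (g x) ∂μ := by
  rw [L2.inner_def]
  refine integral_congr_ae ?_
  filter_upwards [coeFn_mulL2 ha f] with x hx
  rw [hx, real_inner_smul_left]

theorem integrable_mul_inner {a : α → ℝ} (ha : MemLp a ⊤ μ) (f g : Lp E 2 μ) :
    Integrable (fun x => a x * inner ℝ (f x) (g x)) μ := by
  refine (L2.integrable_inner (𝕜 := ℝ) (mulL2 ha f) g).congr ?_
  filter_upwards [coeFn_mulL2 ha f] with x hx
  rw [hx, real_inner_smul_left]

theorem inner_mulL2_comm {a : α → ℝ} (ha : MemLp a ⊤ μ) (f g : Lp E 2 μ) :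
    inner ℝ (mulL2 ha f) g = inner ℝ (mulL2 ha g) f := by
  simp_rw [inner_mulL2, real_inner_comm]

theorem mul_norm_sq_le_inner_mulL2 {a : α → ℝ} (ha : MemLp a ⊤ μ) {m : ℝ} (hm : ∀ᵐ x ∂μ, m ≤ a x)
    (f : Lp E 2 μ) : m * ‖f‖ ^ 2 ≤ inner ℝ (mulL2 ha f) f := by
  rw [← real_inner_self_eq_norm_sq, inner_mulL2, L2.inner_def, ← integral_const_mul]
  refine integral_mono_ae ((L2.integrable_inner (𝕜 := ℝ) f f).const_mul m)
    (integrable_mul_inner ha f f) ?_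
  filter_upwards [hm] with x hx
  exact mul_le_mul_of_nonneg_right hx real_inner_self_nonneg

end Multiplication

/-! ### The Lax–Milgram theorem on closed subspaces -/

/-- The triples carry the sup norm of a product, which is not Hilbertian. The problem is pulled back
through `Φ` to a closed subspace of a Hilbert space; coercivity survives with `c / K ^ 2`, where `K`
bounds the inverse of `Φ`. -/
theorem exists_forall_eq_of_coercive {E P : Type*} [NormedAddCommGroup E] [InnerProductSpace ℝ E]
    [CompleteSpace E] [NormedAddCommGroup P] [NormedSpace ℝ P] (Φ : E ≃L[ℝ] P)
    {W : Submodule ℝ P} (hW : IsClosed (W : Set P)) (B : P →L[ℝ] P →L[ℝ] ℝ) {c : ℝ} (hc : 0 < c)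
    (hB : ∀ x ∈ W, c * ‖x‖ ^ 2 ≤ B x x) (l : P →L[ℝ] ℝ) :
    ∃ x ∈ W, ∀ y ∈ W, B x y = l y := by
  let W' : Submodule ℝ E := W.comap (Φ : E →ₗ[ℝ] P)
  have hW' : IsClosed (W' : Set E) := hW.preimage Φ.continuous
  have : CompleteSpace W' := hW'.completeSpace_coe
  let j : W' →L[ℝ] P := (Φ : E →L[ℝ] P).comp W'.subtypeL
  have hj : ∀ x, j x ∈ W := fun x => x.2
  let B' : W' →L[ℝ] W' →L[ℝ] ℝ := B.bilinearComp j j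
  have hB' : ∀ x y, B' x y = B (j x) (j y) := fun x y => rfl
  have hΦ : ∃ K : ℝ, 0 < K ∧ ∀ x : E, ‖x‖ ≤ K * ‖Φ x‖ := by
    refine ⟨‖(Φ.symm : P →L[ℝ] E)‖ + 1, by positivity, fun x => ?_⟩
    have := (Φ.symm : P →L[ℝ] E).le_opNorm (Φ x)
    simp only [ContinuousLinearEquiv.coe_coe, ContinuousLinearEquiv.symm_apply_apply] at this
    nlinarith [norm_nonneg (Φ x)]
  obtain ⟨K, hK, hΦ⟩ := hΦ
  have hco : IsCoercive B' := by
    refine ⟨c / K ^ 2, by positivity, fun x => ?_⟩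
    rw [hB']
    refine le_trans ?_ (hB _ (hj x))
    have h1 : ‖x‖ ≤ K * ‖j x‖ := hΦ x
    have h2 : ‖x‖ ^ 2 ≤ (K * ‖j x‖) ^ 2 := by gcongr
    rw [mul_assoc, ← sq, div_mul_eq_mul_div, div_le_iff₀ (by positivity)]
    nlinarith
  let r : W' := (InnerProductSpace.toDual ℝ W').symm (l.comp j)
  refine ⟨j (hco.continuousLinearEquivOfBilin.symm r), hj _, fun y hy => ?_⟩
  let y' : W' := ⟨Φ.symm y, by simpa [W'] using hy⟩
  have hy' : j y' = y := by simp [j, y']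
  have h1 := hco.continuousLinearEquivOfBilin_apply (hco.continuousLinearEquivOfBilin.symm r) y'
  rw [ContinuousLinearEquiv.apply_symm_apply, InnerProductSpace.toDual_symm_apply, hB', hy'] at h1
  rw [← h1]
  simp [hy']

namespace Setting

/-! ### Estimates for the limits of smooth functions -/

variable {D : Setting}

theorem exists_norm_trace_sq_le : ∃ C : ℝ, 0 ≤ C ∧ ∀ x ∈ D.smooth.topologicalClosure,
    ‖x.2.2‖ ^ 2 ≤ C * (‖x.1‖ ^ 2 + ‖x.2.1‖ ^ 2) := by
  obtain ⟨C, hC, h⟩ := exists_trace_le D.isOpen D.isBounded D.lipschitz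
  refine ⟨C.toReal, ENNReal.toReal_nonneg, fun x hx => ?_⟩
  have hclosed : IsClosed {x : D.Triple | ‖x.2.2‖ ^ 2 ≤ C.toReal * (‖x.1‖ ^ 2 + ‖x.2.1‖ ^ 2)} :=
    isClosed_le (by fun_prop) (by fun_prop)
  refine closure_minimal ?_ hclosed hx
  rintro y ⟨u, hu, h1, h2, h3⟩
  have key : ‖y.2.2‖ₑ ^ 2 ≤ C * (‖y.1‖ₑ ^ 2 + ‖y.2.1‖ₑ ^ 2) := by
    rw [enorm_sq_eq_lintegral h1, enorm_sq_eq_lintegral h2, enorm_sq_eq_lintegral h3]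
    exact h u hu
  have := ENNReal.toReal_mono (by finiteness) key
  rwa [ENNReal.toReal_mul, ENNReal.toReal_add (by finiteness) (by finiteness),
    ENNReal.toReal_pow, ENNReal.toReal_pow, ENNReal.toReal_pow, toReal_enorm, toReal_enorm,
    toReal_enorm] at this

theorem inner_const_one (s : D.L2) : inner ℝ (D.const 1) s = ∫ x in D.Ω, s x := by
  rw [L2.inner_def]
  refine integral_congr_ae ?_
  filter_upwards [coeFn_const (D := D) 1] with x hx
  rw [hx]; simp

theorem volume_real_pos : 0 < volume.real D.Ω :=
  ENNReal.toReal_pos (D.isOpen.measure_pos volume D.isConnected.nonempty).ne'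
    D.isBounded.measure_lt_top.ne

theorem inner_const_one_const_one : inner ℝ (D.const 1) (D.const 1) = volume.real D.Ω := by
  rw [inner_const_one, integral_congr_ae (coeFn_const (D := D) 1)]
  simp

variable (D) in
/-- The average over `Ω`. -/
def mean : D.L2 →L[ℝ] ℝ := (volume.real D.Ω)⁻¹ • innerSL ℝ (D.const 1)

theorem mean_apply (s : D.L2) : D.mean s = (volume.real D.Ω)⁻¹ * ∫ x in D.Ω, s x := by
  rw [← inner_const_one]; rfl

theorem mean_const (r : ℝ) : D.mean (D.const r) = r := by
  rw [const_eq_smul, map_smul, mean_apply, ← inner_const_one, inner_const_one_const_one,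
    inv_mul_cancel₀ volume_real_pos.ne', smul_eq_mul, mul_one]

/-- The mean gives the orthogonal projection onto the constants. It replaces the unspecified
constant of the Poincaré inequality by one that depends continuously on `s`, so that the inequality
passes to the closure. -/
theorem norm_sub_mean_sq_le (s : D.L2) (k : ℝ) :
    ‖s - D.const (D.mean s)‖ ^ 2 ≤ ‖s - D.const k‖ ^ 2 := by
  have horth : inner ℝ (s - D.const (D.mean s)) (D.const (D.mean s - k)) = 0 := by
    rw [const_eq_smul (D.mean s - k), real_inner_smul_right, real_inner_comm, inner_const_one]
    have h : D.mean (s - D.const (D.mean s)) = 0 := by rw [map_sub, mean_const, sub_self]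
    rw [mean_apply] at h
    rw [(mul_eq_zero.1 h).resolve_left (inv_ne_zero volume_real_pos.ne'), mul_zero]
  have hsum : s - D.const k = (s - D.const (D.mean s)) + D.const (D.mean s - k) := by
    rw [const_eq_smul k, const_eq_smul (D.mean s), const_eq_smul (D.mean s - k), sub_smul]
    abel
  rw [hsum, norm_add_sq_real, horth]
  nlinarith [sq_nonneg ‖D.const (D.mean s - k)‖]

theorem exists_norm_sub_mean_sq_le : ∃ C : ℝ, 0 ≤ C ∧ ∀ x ∈ D.smooth.topologicalClosure,
    ‖x.1 - D.const (D.mean x.1)‖ ^ 2 ≤ C * ‖x.2.1‖ ^ 2 := by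
  obtain ⟨C, hC, h⟩ := poincareOn_self D.isOpen D.isConnected D.isBounded D.lipschitz
  refine ⟨C.toReal, ENNReal.toReal_nonneg, fun x hx => ?_⟩
  have hcont : Continuous fun x : D.Triple => D.const (D.mean x.1) := by
    simp_rw [const_eq_smul (D.mean _)]
    fun_prop
  have hclosed : IsClosed {x : D.Triple |
      ‖x.1 - D.const (D.mean x.1)‖ ^ 2 ≤ C.toReal * ‖x.2.1‖ ^ 2} :=
    isClosed_le (by fun_prop) (by fun_prop)
  refine closure_minimal ?_ hclosed hx
  rintro y ⟨u, hu, h1, h2, -⟩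
  obtain ⟨m, hm⟩ := h u hu
  refine (norm_sub_mean_sq_le y.1 m).trans (norm_sq_le_of_enorm_sq_le hC ?_)
  have h3 : (y.1 - D.const m : D.L2) =ᵐ[volume.restrict D.Ω] fun x => u x - m := by
    filter_upwards [Lp.coeFn_sub y.1 (D.const m), h1, coeFn_const (D := D) m] with x a b c
    rw [a, Pi.sub_apply, b, c]
  rw [enorm_sq_eq_lintegral h2, enorm_sq_eq_lintegral h3]
  exact hm

theorem exists_norm_sub_smul_one_le : ∃ C : ℝ, 0 ≤ C ∧ ∀ x ∈ D.smooth.topologicalClosure,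
    ‖x - D.mean x.1 • D.one‖ ≤ C * ‖x.2.1‖ := by
  obtain ⟨C₁, h₁, hP⟩ := D.exists_norm_sub_mean_sq_le
  obtain ⟨C₂, h₂, hT⟩ := D.exists_norm_trace_sq_le
  -- `C₁`, `1` and `C₂ * (C₁ + 1)` bound the function, the gradient and the trace of `y`; the trace
  -- inequality is applied to `y`, whose gradient is that of `x`.
  refine ⟨√(C₁ + 1 + C₂ * (C₁ + 1)), Real.sqrt_nonneg _, fun x hx => ?_⟩
  set y := x - D.mean x.1 • D.one with hy
  have hyc : y ∈ D.smooth.topologicalClosure :=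
    sub_mem hx (Submodule.smul_mem _ _ (D.smooth.le_topologicalClosure one_mem_smooth))
  have hy1 : y.1 = x.1 - D.const (D.mean x.1) := by rw [const_eq_smul]; rfl
  have hy2 : y.2.1 = x.2.1 := by simp [hy, one]
  have hP' := hP x hx
  have hT' := hT y hyc
  rw [hy2] at hT'
  rw [← hy1] at hP'
  have hG := sq_nonneg ‖x.2.1‖
  have hG1 : 0 ≤ C₁ * ‖x.2.1‖ ^ 2 := by positivity
  have hG2 : 0 ≤ C₂ * ((C₁ + 1) * ‖x.2.1‖ ^ 2) := by positivity
  have hT'' : ‖y.2.2‖ ^ 2 ≤ C₂ * ((C₁ + 1) * ‖x.2.1‖ ^ 2) :=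
    hT'.trans (mul_le_mul_of_nonneg_left (by linarith) h₂)
  have hb : ∀ r : ℝ, r ^ 2 ≤ (C₁ + 1 + C₂ * (C₁ + 1)) * ‖x.2.1‖ ^ 2 →
      r ≤ √(C₁ + 1 + C₂ * (C₁ + 1)) * ‖x.2.1‖ := fun r hr => by
    refine le_of_sq_le_sq ?_ (by positivity)
    rwa [mul_pow, Real.sq_sqrt (by positivity)]
  rw [Prod.norm_def, Prod.norm_def]
  refine max_le (hb _ ?_) (max_le (hb _ ?_) (hb _ ?_))
  · nlinarith
  · rw [hy2]; nlinarith
  · nlinarith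

/-! ### The energy form -/

variable (D) in
/-- The weight `a` on `ΓR` and `1` on `ΓD`. -/
def weight : Plane → ℝ := D.ΓR.indicator D.a + D.ΓD.indicator fun _ => 1

theorem memLp_weight : MemLp D.weight ⊤ (bdryMeasure D.Ω) := by
  refine MemLp.add ?_ ((memLp_const 1).indicator D.measurable_ΓD)
  rw [memLp_indicator_iff_restrict D.measurable_ΓR,
    Measure.restrict_restrict D.measurable_ΓR, Set.inter_eq_left.2 ΓR_subset]
  exact D.a_bdd

theorem ae_bdry_of_ae_restrict {S : Set Plane} (hm : MeasurableSet S) {p : Plane → Prop}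
    (h : ∀ᵐ x ∂((μH[1]).restrict S), p x) : ∀ᵐ x ∂(bdryMeasure D.Ω), x ∈ S → p x := by
  rw [ae_restrict_iff' hm] at h
  exact ae_restrict_of_ae h

theorem weight_eq_zero {x : Plane} (hR : x ∉ D.ΓR) (hD : x ∉ D.ΓD) : D.weight x = 0 := by
  simp [weight, hR, hD]

theorem weight_nonneg : ∀ᵐ x ∂(bdryMeasure D.Ω), 0 ≤ D.weight x := by
  filter_upwards [ae_bdry_of_ae_restrict D.measurable_ΓR D.a_pos] with x hx
  refine add_nonneg ?_ (Set.indicator_nonneg (fun _ _ => zero_le_one) x)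
  by_cases h : x ∈ D.ΓR
  · simpa [h] using (hx h).le
  · simp [h]

variable (D) in
/-- The energy form on all triples. -/
def energy : D.Triple →L[ℝ] D.Triple →L[ℝ] ℝ :=
  (innerSL ℝ).bilinearComp (mulL2 D.σ_bdd ∘L ContinuousLinearMap.fst ℝ D.L2vec D.L2bdry ∘L
      ContinuousLinearMap.snd ℝ D.L2 _)
    (ContinuousLinearMap.fst ℝ D.L2vec D.L2bdry ∘L ContinuousLinearMap.snd ℝ D.L2 _) +
  (innerSL ℝ).bilinearComp (mulL2 D.memLp_weight ∘L ContinuousLinearMap.snd ℝ D.L2vec D.L2bdry ∘L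
      ContinuousLinearMap.snd ℝ D.L2 _)
    (ContinuousLinearMap.snd ℝ D.L2vec D.L2bdry ∘L ContinuousLinearMap.snd ℝ D.L2 _)

theorem energy_apply (x y : D.Triple) : D.energy x y =
    inner ℝ (mulL2 D.σ_bdd x.2.1) y.2.1 + inner ℝ (mulL2 memLp_weight x.2.2) y.2.2 := rfl

theorem energy_comm (x y : D.Triple) : D.energy x y = D.energy y x := by
  rw [energy_apply, energy_apply, inner_mulL2_comm, inner_mulL2_comm memLp_weight]

/-- The extra weight `1` on `ΓD` contributes nothing because the trace of `x` vanishes there. Its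
purpose is that one boundary form detects constants through `ΓD` and `ΓR` alike. -/
theorem form_eq_energy {x : D.Triple} (hx : x ∈ D.V) (y : D.Triple) :
    D.form x.2.1 x.2.2 y.2.1 y.2.2 = D.energy x y := by
  rw [energy_apply, inner_mulL2, inner_mulL2, form]
  congr 1
  have h1 : ∫ z in D.ΓR, D.a z * x.2.2 z * y.2.2 z ∂μH[1] =
      ∫ z, D.ΓR.indicator (fun z => D.a z * x.2.2 z * y.2.2 z) z ∂(bdryMeasure D.Ω) := by
    rw [integral_indicator D.measurable_ΓR, Measure.restrict_restrict D.measurable_ΓR,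
      Set.inter_eq_left.2 ΓR_subset]
  rw [h1]
  refine integral_congr_ae ?_
  filter_upwards [ae_bdry_of_ae_restrict D.measurable_ΓD hx.2.1] with z hz
  by_cases hR : z ∈ D.ΓR
  · have hD : z ∉ D.ΓD := fun h => Set.disjoint_left.1 D.disjoint_DR h hR
    simp [weight, hR, hD]; ring
  · by_cases hD : z ∈ D.ΓD
    · have := hz hD
      simp only [LinearMap.comp_apply, LinearMap.snd_apply] at this
      simp [hR, this]
    · rw [weight_eq_zero hR hD]
      simp [hR]

theorem energy_eq_of_not_controlled (h : ¬ D.ConstantsControlled) (x y : D.Triple) :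
    D.energy x y = inner ℝ (mulL2 D.σ_bdd x.2.1) y.2.1 := by
  have h0 : ∀ᵐ z ∂(bdryMeasure D.Ω), D.weight z = 0 := by
    have : ∀ᵐ z ∂(μH[1] : Measure Plane), z ∉ D.ΓD ∪ D.ΓR :=
      measure_eq_zero_iff_ae_notMem.1 (not_not.1 h)
    filter_upwards [ae_restrict_of_ae this] with z hz
    exact weight_eq_zero (fun h => hz (Or.inr h)) (fun h => hz (Or.inl h))
  rw [energy_apply, inner_mulL2 memLp_weight, add_eq_left]
  refine integral_eq_zero_of_ae ?_
  filter_upwards [h0] with z hz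
  simp [hz]

theorem energy_one_of_not_controlled (h : ¬ D.ConstantsControlled) (x : D.Triple) :
    D.energy D.one x = 0 := by
  have : D.one.2.1 = 0 := rfl
  rw [energy_eq_of_not_controlled h, this, map_zero, inner_zero_left]

theorem weight_pos_of_controlled (h : D.ConstantsControlled) :
    0 < inner ℝ (mulL2 memLp_weight D.one.2.2) D.one.2.2 := by
  have h1 : ∀ᵐ x ∂(bdryMeasure D.Ω), D.one.2.2 x = 1 := Lp.coeFn_const _ _ _
  rw [inner_mulL2]
  have h2 : ∫ x, D.weight x * inner ℝ (D.one.2.2 x) (D.one.2.2 x) ∂(bdryMeasure D.Ω) =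
      ∫ x, D.weight x ∂(bdryMeasure D.Ω) := by
    refine integral_congr_ae ?_
    filter_upwards [h1] with x hx
    simp [hx]
  rw [h2, integral_pos_iff_support_of_nonneg_ae weight_nonneg
    (memLp_weight.integrable le_top)]
  refine pos_iff_ne_zero.2 fun h0 => h ?_
  have hsub : ∀ᵐ x ∂(bdryMeasure D.Ω), x ∉ D.ΓD ∪ D.ΓR := by
    filter_upwards [measure_eq_zero_iff_ae_notMem.1 h0,
      ae_bdry_of_ae_restrict D.measurable_ΓR D.a_pos] with x hx ha hmem
    refine hx ?_
    rw [Function.mem_support]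
    rcases hmem with hD | hR
    · have hR : x ∉ D.ΓR := fun h => Set.disjoint_left.1 D.disjoint_DR hD h
      simp [weight, hD, hR]
    · have hD : x ∉ D.ΓD := fun h => Set.disjoint_left.1 D.disjoint_DR h hR
      simpa [weight, hD, hR] using (ha hR).ne'
  have := measure_eq_zero_iff_ae_notMem.2 hsub
  rwa [Measure.restrict_apply (D.measurable_ΓD.union D.measurable_ΓR),
    Set.inter_eq_left.2 (Set.union_subset ΓD_subset ΓR_subset)] at this

theorem exists_mul_norm_grad_sq_le_energy :
    ∃ m : ℝ, 0 < m ∧ ∀ x : D.Triple,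
      m * ‖x.2.1‖ ^ 2 + inner ℝ (mulL2 memLp_weight x.2.2) x.2.2 ≤ D.energy x x := by
  obtain ⟨m, hm, hσ⟩ := D.σ_pos
  refine ⟨m, hm, fun x => ?_⟩
  rw [energy_apply]
  gcongr
  exact mul_norm_sq_le_inner_mulL2 D.σ_bdd hσ x.2.1

theorem inner_weight_nonneg (g : D.L2bdry) : 0 ≤ inner ℝ (mulL2 memLp_weight g) g := by
  simpa using mul_norm_sq_le_inner_mulL2 memLp_weight weight_nonneg g

/-- Split `x = y + k • one` with `k` the mean. The gradient bounds `y`, and the boundary form `Q`,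
which is positive on `one`, bounds `k` through the traces of `x` and `y`. -/
theorem energy_coercive_of_controlled (h : D.ConstantsControlled) :
    ∃ c : ℝ, 0 < c ∧ ∀ x ∈ D.V, c * ‖x‖ ^ 2 ≤ D.energy x x := by
  obtain ⟨C, hC, hP⟩ := D.exists_norm_sub_smul_one_le
  obtain ⟨m, hm, hE⟩ := D.exists_mul_norm_grad_sq_le_energy
  set Q : D.L2bdry → D.L2bdry → ℝ := fun g g' => inner ℝ (mulL2 memLp_weight g) g' with hQ
  set q := Q D.one.2.2 D.one.2.2 with hq
  have hq0 : 0 < q := weight_pos_of_controlled h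
  set M := ‖(mulL2 D.memLp_weight : D.L2bdry →L[ℝ] D.L2bdry)‖ with hM
  have hM0 : 0 ≤ M := norm_nonneg _
  set N := ‖D.one‖ with hN
  -- `A` collects the multiples of `‖x.2.1‖ ^ 2` in the bound for `‖x‖ ^ 2`: the first from `y`, the
  -- second from the contribution of `y` to the bound for `k`.
  set A := 2 * C ^ 2 + 4 * N ^ 2 * M * C ^ 2 / q with hA
  have hA0 : 0 ≤ A := by positivity
  have hkey : ∀ x ∈ D.V, ‖x‖ ^ 2 ≤ (A / m + 4 * N ^ 2 / q + 1) * D.energy x x := by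
    intro x hx
    set k := D.mean x.1
    set y := x - k • D.one with hy
    have hyn : ‖y‖ ≤ C * ‖x.2.1‖ := hP x hx.1
    have hyn2 : ‖y‖ ^ 2 ≤ C ^ 2 * ‖x.2.1‖ ^ 2 := by
      rw [← mul_pow]; gcongr
    have hQy : Q y.2.2 y.2.2 ≤ M * (C ^ 2 * ‖x.2.1‖ ^ 2) := by
      calc Q y.2.2 y.2.2 ≤ ‖mulL2 D.memLp_weight y.2.2‖ * ‖y.2.2‖ := real_inner_le_norm _ _
        _ ≤ M * ‖y.2.2‖ * ‖y.2.2‖ := by gcongr; exact ContinuousLinearMap.le_opNorm _ _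
        _ = M * ‖y.2.2‖ ^ 2 := by ring
        _ ≤ M * ‖y‖ ^ 2 := by
            gcongr
            exact (norm_snd_le y.2).trans (norm_snd_le y)
        _ ≤ _ := by gcongr
    have hQx := inner_weight_nonneg (D := D) x.2.2
    have hk : k ^ 2 * q ≤ 2 * Q x.2.2 x.2.2 + 2 * Q y.2.2 y.2.2 := by
      -- Parallelogram identity for `Q`, since the traces of `x` and `y` differ by `k • D.one.2.2`.
      have hpar : k ^ 2 * q + Q (x.2.2 + y.2.2) (x.2.2 + y.2.2) =
          2 * Q x.2.2 x.2.2 + 2 * Q y.2.2 y.2.2 := by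
        have hko : k • D.one.2.2 = x.2.2 - y.2.2 := by simp [hy]
        have : k ^ 2 * q = Q (k • D.one.2.2) (k • D.one.2.2) := by
          simp only [hq, hQ, map_smul, real_inner_smul_left, real_inner_smul_right]; ring
        rw [this, hko]
        simp only [hQ, map_sub, map_add, inner_sub_left, inner_sub_right, inner_add_left,
          inner_add_right]
        ring
      have : 0 ≤ Q (x.2.2 + y.2.2) (x.2.2 + y.2.2) := inner_weight_nonneg _
      linarith
    have hxn : ‖x‖ ≤ ‖y‖ + |k| * N := by
      have : x = y + k • D.one := by simp [hy]
      calc ‖x‖ = ‖y + k • D.one‖ := by rw [← this]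
        _ ≤ _ := (norm_add_le _ _).trans (by rw [norm_smul, Real.norm_eq_abs])
    have hxn2 : ‖x‖ ^ 2 ≤ 2 * ‖y‖ ^ 2 + 2 * (k ^ 2 * N ^ 2) := by
      have h1 : ‖x‖ ^ 2 ≤ (‖y‖ + |k| * N) ^ 2 := by gcongr
      have h2 : (|k| * N) ^ 2 = k ^ 2 * N ^ 2 := by rw [mul_pow, sq_abs]
      nlinarith [sq_nonneg (‖y‖ - |k| * N)]
    have hk' : k ^ 2 ≤ (2 * Q x.2.2 x.2.2 + 2 * (M * (C ^ 2 * ‖x.2.1‖ ^ 2))) / q := by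
      rw [le_div_iff₀ hq0]; linarith
    have hE' := hE x
    have hgrad : ‖x.2.1‖ ^ 2 ≤ D.energy x x / m := by
      rw [le_div_iff₀ hm]; linarith
    have hQE : Q x.2.2 x.2.2 ≤ D.energy x x := by
      have : 0 ≤ m * ‖x.2.1‖ ^ 2 := by positivity
      linarith
    have hE0 : 0 ≤ D.energy x x := hQx.trans hQE
    calc ‖x‖ ^ 2 ≤ 2 * (C ^ 2 * ‖x.2.1‖ ^ 2) +
          2 * ((2 * Q x.2.2 x.2.2 + 2 * (M * (C ^ 2 * ‖x.2.1‖ ^ 2))) / q * N ^ 2) := by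
          refine hxn2.trans ?_
          gcongr
      _ = A * ‖x.2.1‖ ^ 2 + 4 * N ^ 2 / q * Q x.2.2 x.2.2 := by
          rw [hA]; field_simp; ring
      _ ≤ A * (D.energy x x / m) + 4 * N ^ 2 / q * D.energy x x := by gcongr
      _ = (A / m + 4 * N ^ 2 / q) * D.energy x x := by ring
      _ ≤ _ := by linarith
  refine ⟨(A / m + 4 * N ^ 2 / q + 1)⁻¹, by positivity, fun x hx => ?_⟩
  rw [inv_mul_le_iff₀ (by positivity)]
  exact hkey x hx

variable (D) in
/-- The admissible functions with zero average. -/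
def V₀ : Submodule ℝ D.Triple :=
  D.V ⊓ LinearMap.ker ((D.mean ∘L ContinuousLinearMap.fst ℝ D.L2 (D.L2vec × D.L2bdry)) :
    D.Triple →ₗ[ℝ] ℝ)

theorem mem_V₀_iff {x : D.Triple} : x ∈ D.V₀ ↔ x ∈ D.V ∧ D.mean x.1 = 0 := Iff.rfl

theorem isClosed_V₀ : IsClosed (D.V₀ : Set D.Triple) :=
  isClosed_V.inter
    (D.mean ∘L ContinuousLinearMap.fst ℝ D.L2 (D.L2vec × D.L2bdry)).isClosed_ker

/-- With zero mean the gradient alone bounds the whole triple, whatever the boundary conditions. -/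
theorem energy_coercive_mean_zero :
    ∃ c : ℝ, 0 < c ∧ ∀ x ∈ D.V₀, c * ‖x‖ ^ 2 ≤ D.energy x x := by
  obtain ⟨C, hC, hP⟩ := D.exists_norm_sub_smul_one_le
  obtain ⟨m, hm, hE⟩ := D.exists_mul_norm_grad_sq_le_energy
  refine ⟨m / (C ^ 2 + 1), by positivity, fun x hx => ?_⟩
  obtain ⟨hxV, hmean⟩ := mem_V₀_iff.1 hx
  have h1 := hP x hxV.1
  rw [hmean, zero_smul, sub_zero] at h1
  have h2 : ‖x‖ ^ 2 ≤ (C ^ 2 + 1) * ‖x.2.1‖ ^ 2 := by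
    calc ‖x‖ ^ 2 ≤ (C * ‖x.2.1‖) ^ 2 := by gcongr
      _ ≤ _ := by nlinarith [sq_nonneg ‖x.2.1‖]
  have h3 := hE x
  have h4 := inner_weight_nonneg (D := D) x.2.2
  calc m / (C ^ 2 + 1) * ‖x‖ ^ 2 ≤ m / (C ^ 2 + 1) * ((C ^ 2 + 1) * ‖x.2.1‖ ^ 2) := by gcongr
    _ = m * ‖x.2.1‖ ^ 2 := by field_simp
    _ ≤ _ := by linarith

variable (D) in
/-- The Hilbert space structure on triples. -/
def hilbertEquiv : WithLp 2 (D.L2 × WithLp 2 (D.L2vec × D.L2bdry)) ≃L[ℝ] D.Triple :=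
  (WithLp.prodContinuousLinearEquiv 2 ℝ D.L2 (WithLp 2 (D.L2vec × D.L2bdry))).trans
    ((ContinuousLinearEquiv.refl ℝ D.L2).prodCongr
      (WithLp.prodContinuousLinearEquiv 2 ℝ D.L2vec D.L2bdry))

end Setting
end Graetz
end

noncomputable section

namespace Graetz
namespace Setting

variable {D : Setting}

theorem energy_add_left (x y v : D.Triple) :
    D.energy (x + y) v = D.energy x v + D.energy y v := by
  rw [map_add]; rfl

theorem energy_smul_left (k : ℝ) (x v : D.Triple) : D.energy (k • x) v = k * D.energy x v := by
  rw [map_smul]; rfl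

theorem energy_sub_left (x y v : D.Triple) :
    D.energy (x - y) v = D.energy x v - D.energy y v := by
  rw [map_sub]; rfl

/-! ### The inverse of the Laplacian -/

theorem inner_toLp {f : Plane → ℝ} (hf : MemLp f 2 (volume.restrict D.Ω)) (v : D.L2) :
    inner ℝ (hf.toLp f) v = ∫ x in D.Ω, f x * v x := by
  rw [L2.inner_def]
  refine integral_congr_ae ?_
  filter_upwards [hf.coeFn_toLp] with x hx
  rw [hx]; simp [mul_comm]

theorem inner_mulL2_eq {a : Plane → ℝ} (ha : MemLp a ⊤ (volume.restrict D.Ω)) (s v : D.L2) :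
    inner ℝ (mulL2 ha s) v = ∫ x in D.Ω, a x * s x * v x := by
  rw [inner_mulL2]
  refine integral_congr_ae (Eventually.of_forall fun x => ?_)
  simp; ring

theorem isInvLaplacian_iff {f : Plane → ℝ} (hf : MemLp f 2 (volume.restrict D.Ω)) {u : D.L2} :
    D.IsInvLaplacian f u ↔
      ∃ x ∈ D.V, x.1 = u ∧ ∀ v ∈ D.V, D.energy x v = -inner ℝ (hf.toLp f) v.1 := by
  constructor
  · rintro ⟨G, g, hadm, h⟩
    have hx : ((u, G, g) : D.Triple) ∈ D.V := mem_V_iff.2 hadm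
    refine ⟨(u, G, g), hx, rfl, fun v hv => ?_⟩
    rw [← form_eq_energy hx, inner_toLp]
    exact h _ _ _ (mem_V_iff.1 hv)
  · rintro ⟨x, hx, rfl, h⟩
    refine ⟨x.2.1, x.2.2, mem_V_iff.1 hx, fun v Gv gv hv => ?_⟩
    have := h (v, Gv, gv) (mem_V_iff.2 hv)
    rwa [← form_eq_energy hx, inner_toLp] at this

theorem existsUnique_isInvLaplacian (h : D.ConstantsControlled) {f : Plane → ℝ}
    (hf : MemLp f 2 (volume.restrict D.Ω)) : ∃! q : D.L2, D.IsInvLaplacian f q := by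
  obtain ⟨c, hc, hco⟩ := energy_coercive_of_controlled h
  obtain ⟨x, hx, hxe⟩ := exists_forall_eq_of_coercive D.hilbertEquiv isClosed_V D.energy hc hco
    (-(innerSL ℝ (hf.toLp f) ∘L ContinuousLinearMap.fst ℝ D.L2 (D.L2vec × D.L2bdry)))
  refine ⟨x.1, (isInvLaplacian_iff hf).2 ⟨x, hx, rfl, hxe⟩, fun u hu => ?_⟩
  obtain ⟨y, hy, rfl, hye⟩ := (isInvLaplacian_iff hf).1 hu
  have hd : y - x ∈ D.V := sub_mem hy hx
  have h0 : D.energy (y - x) (y - x) = 0 := by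
    rw [energy_sub_left, hye _ hd, hxe _ hd]
    exact sub_self _
  have h1 := hco _ hd
  rw [h0] at h1
  have h2 : ‖y - x‖ ^ 2 = 0 := le_antisymm (nonpos_of_mul_nonpos_right h1 hc) (sq_nonneg _)
  have h3 : y = x := by simpa [sub_eq_zero] using h2
  rw [h3]

theorem sub_mean_mem_V₀ (h : ¬ D.ConstantsControlled) {v : D.Triple} (hv : v ∈ D.V) :
    v - D.mean v.1 • D.one ∈ D.V₀ := by
  refine mem_V₀_iff.2 ⟨sub_mem hv (Submodule.smul_mem _ _ (one_mem_V h)), ?_⟩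
  have : (v - D.mean v.1 • D.one).1 = v.1 - D.const (D.mean v.1) := by rw [const_eq_smul]; rfl
  rw [this, map_sub, mean_const, sub_self]

/-- Lax–Milgram on `V₀` gives the equation for test functions of zero mean. It extends to `V`
because both sides vanish on constants: the energy since they are not controlled, the source since
its average is zero. -/
theorem exists_energy_eq (h : ¬ D.ConstantsControlled) {f : Plane → ℝ}
    (hf : MemLp f 2 (volume.restrict D.Ω)) (hf0 : ∫ x in D.Ω, f x = 0) :
    ∃ x ∈ D.V, ∀ v ∈ D.V, D.energy x v = -inner ℝ (hf.toLp f) v.1 := by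
  obtain ⟨c, hc, hco⟩ := D.energy_coercive_mean_zero
  obtain ⟨x, hx, hxe⟩ := exists_forall_eq_of_coercive D.hilbertEquiv isClosed_V₀ D.energy hc hco
    (-(innerSL ℝ (hf.toLp f) ∘L ContinuousLinearMap.fst ℝ D.L2 (D.L2vec × D.L2bdry)))
  have hone : inner ℝ (hf.toLp f) D.one.1 = 0 := by
    rw [real_inner_comm]
    refine (inner_const_one _).trans ?_
    rw [integral_congr_ae hf.coeFn_toLp, hf0]
  refine ⟨x, (mem_V₀_iff.1 hx).1, fun v hv => ?_⟩
  have h1 := hxe _ (sub_mean_mem_V₀ h hv)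
  rw [map_sub, map_smul, energy_comm x D.one, energy_one_of_not_controlled h, smul_zero,
    sub_zero] at h1
  rw [h1]
  simp [inner_sub_right, real_inner_smul_right, hone]

/-- Zero energy forces a zero gradient, and the Poincaré inequality then leaves only a constant.
Applied to the difference of two solutions it gives uniqueness modulo constants. -/
theorem eq_smul_one_of_energy_self_eq_zero {d : D.Triple} (hd : d ∈ D.V)
    (h : D.energy d d = 0) : d = D.mean d.1 • D.one := by
  obtain ⟨C, hC, hP⟩ := D.exists_norm_sub_smul_one_le
  obtain ⟨m, hm, hE⟩ := D.exists_mul_norm_grad_sq_le_energy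
  have h1 := hE d
  have h2 := inner_weight_nonneg (D := D) d.2.2
  have h3 : m * ‖d.2.1‖ ^ 2 ≤ 0 := by linarith
  have h4 : ‖d.2.1‖ = 0 :=
    pow_eq_zero_iff two_ne_zero |>.1
      (le_antisymm (nonpos_of_mul_nonpos_right h3 hm) (sq_nonneg _))
  have h5 := hP d hd.1
  rw [h4, mul_zero] at h5
  exact sub_eq_zero.1 (norm_le_zero_iff.1 h5)

theorem invLaplacianModConst (h : ¬ D.ConstantsControlled) {f : Plane → ℝ}
    (hf : MemLp f 2 (volume.restrict D.Ω)) (hf0 : ∫ x in D.Ω, f x = 0) :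
    D.InvLaplacianModConst f := by
  obtain ⟨x, hx, hxe⟩ := exists_energy_eq h hf hf0
  refine ⟨x.1, fun u => ?_⟩
  rw [isInvLaplacian_iff hf]
  constructor
  · rintro ⟨y, hy, rfl, hye⟩
    have hd : y - x ∈ D.V := sub_mem hy hx
    have h0 : D.energy (y - x) (y - x) = 0 := by
      rw [energy_sub_left, hye _ hd, hxe _ hd, sub_self]
    have h1 := eq_smul_one_of_energy_self_eq_zero hd h0
    refine ⟨D.mean (y - x).1, ?_⟩
    rw [const_eq_smul]
    exact congrArg Prod.fst (sub_eq_iff_eq_add'.1 h1)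
  · rintro ⟨k, rfl⟩
    refine ⟨x + k • D.one, add_mem hx (Submodule.smul_mem _ _ (one_mem_V h)), ?_, fun v hv => ?_⟩
    · rw [const_eq_smul]; rfl
    · rw [energy_add_left, energy_smul_left, energy_one_of_not_controlled h, mul_zero, add_zero,
        hxe v hv]

/-! ### The evolution problem -/

/-- With `T`, its gradient and its trace bundled in one curve `X` of triples, every condition is
linear in the pair `(T', X)`, which is the form that superposition needs. -/
theorem isSolution_iff {I : Set ℝ} {f : Plane → ℝ} (hf : MemLp f 2 (volume.restrict D.Ω))
    {T : ℝ → D.L2} :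
    D.IsSolution I f T ↔ ∃ (T' : ℝ → D.L2) (X : ℝ → D.Triple), (∀ z, (X z).1 = T z) ∧
      (∀ z ∈ I, HasDerivWithinAt T (T' z) I z) ∧ ContinuousOn T' I ∧
      ContinuousOn (fun z => (X z).2.1) I ∧ (∀ z ∈ I, X z ∈ D.V) ∧
      ∀ v ∈ D.V, ∀ z ∈ I, HasDerivWithinAt (fun t => inner ℝ (mulL2 D.c_bdd (T' t)) v.1)
        (D.energy (X z) v + inner ℝ (mulL2 D.h_bdd (T' z)) v.1 + inner ℝ (hf.toLp f) v.1) I z := by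
  simp_rw [inner_mulL2_eq, inner_toLp]
  constructor
  · rintro ⟨T', G, g, h1, h2, h3, h4, h5⟩
    have hV : ∀ z ∈ I, ((T z, G z, g z) : D.Triple) ∈ D.V := fun z hz => mem_V_iff.2 (h4 z hz)
    refine ⟨T', fun z => (T z, G z, g z), fun _ => rfl, h1, h2, h3, hV, fun v hv z hz => ?_⟩
    rw [← form_eq_energy (hV z hz)]
    exact h5 _ _ _ (mem_V_iff.1 hv) z hz
  · rintro ⟨T', X, hX, h1, h2, h3, h4, h5⟩
    refine ⟨T', fun z => (X z).2.1, fun z => (X z).2.2, h1, h2, h3, fun z hz => ?_,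
      fun v Gv gv hv z hz => ?_⟩
    · rw [← hX]; exact mem_V_iff.1 (h4 z hz)
    · have := h5 (v, Gv, gv) (mem_V_iff.2 hv) z hz
      rwa [← form_eq_energy (h4 z hz)] at this

theorem IsSolution.add_const_smul {I : Set ℝ} {f₁ f₂ : Plane → ℝ}
    (hf₁ : MemLp f₁ 2 (volume.restrict D.Ω)) (hf₂ : MemLp f₂ 2 (volume.restrict D.Ω))
    {T₁ T₂ : ℝ → D.L2} (h₁ : D.IsSolution I f₁ T₁) (h₂ : D.IsSolution I f₂ T₂) (k : ℝ) :
    D.IsSolution I (f₁ + k • f₂) (fun z => T₁ z + k • T₂ z) := by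
  rw [isSolution_iff hf₁] at h₁
  rw [isSolution_iff hf₂] at h₂
  rw [isSolution_iff (hf₁.add (hf₂.const_smul k))]
  obtain ⟨T₁', X₁, a1, a2, a3, a4, a5, a6⟩ := h₁
  obtain ⟨T₂', X₂, b1, b2, b3, b4, b5, b6⟩ := h₂
  refine ⟨fun z => T₁' z + k • T₂' z, fun z => X₁ z + k • X₂ z, fun z => ?_, fun z hz => ?_, ?_, ?_,
    fun z hz => ?_, fun v hv z hz => ?_⟩
  · rw [← a1, ← b1]; rfl
  · exact (a2 z hz).add ((b2 z hz).const_smul k)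
  · exact a3.add (b3.const_smul k)
  · exact a4.add (b4.const_smul k)
  · exact add_mem (a5 z hz) (Submodule.smul_mem _ _ (b5 z hz))
  · have := (a6 v hv z hz).add ((b6 v hv z hz).const_mul k)
    refine (this.congr_deriv ?_).congr_of_eventuallyEq (Eventually.of_forall fun t => ?_) ?_
    · rw [MemLp.toLp_add hf₁ (hf₂.const_smul k), MemLp.toLp_const_smul k hf₂]
      rw [energy_add_left, energy_smul_left]
      simp only [map_add, map_smul, inner_add_left, real_inner_smul_left]
      ring
    · simp only [Pi.add_apply, map_add, map_smul, inner_add_left, real_inner_smul_left]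
    · simp only [Pi.add_apply, map_add, map_smul, inner_add_left, real_inner_smul_left]

/-- Superposition with factor `-1` removes the source and with factor `1` restores it. -/
theorem reduces_of_isSolution {I : Set ℝ} {f : Plane → ℝ} (hf : MemLp f 2 (volume.restrict D.Ω))
    {S : ℝ → D.L2} (hS : D.IsSolution I f S) : D.Reduces I f S := by
  refine ⟨hS, fun T => ⟨fun hT => ?_, fun hT => ?_⟩⟩
  · convert IsSolution.add_const_smul hf hf hT hS (-1) using 1
    · funext x; simp
    · funext z; rw [neg_one_smul, sub_eq_add_neg]
  · convert IsSolution.add_const_smul (MemLp.zero (p := 2)) hf hT hS 1 using 1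
    · funext x; simp
    · funext z; rw [one_smul, sub_add_cancel]

theorem reduces_of_isInvLaplacian (I : Set ℝ) {f : Plane → ℝ} (hf : MemLp f 2 (volume.restrict D.Ω))
    {q : D.L2} (hq : D.IsInvLaplacian f q) : D.Reduces I f (fun _ => q) := by
  obtain ⟨x, hx, rfl, hxe⟩ := (isInvLaplacian_iff hf).1 hq
  refine reduces_of_isSolution hf ((isSolution_iff hf).2 ⟨fun _ => 0, fun _ => x, fun _ => rfl,
    fun z _ => hasDerivWithinAt_const z I x.1, continuousOn_const, continuousOn_const,
    fun _ _ => hx, fun v hv z _ => ?_⟩)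
  rw [hxe v hv]
  simpa using hasDerivWithinAt_const z I (0 : ℝ)

/-- The term `α z` has zero energy and a constant derivative; its only trace in the equation is `α
h`, which cancels the extra source of `q`. -/
theorem reduces_of_not_balanced (hc : ¬ D.ConstantsControlled) (I : Set ℝ) {f : Plane → ℝ}
    (hf : MemLp f 2 (volume.restrict D.Ω)) {α : ℝ} {q : D.L2}
    (hq : D.IsInvLaplacian (fun x => f x + α * D.h x) q) :
    D.Reduces I f (fun z => D.const (α * z) + q) := by
  have hh : MemLp D.h 2 (volume.restrict D.Ω) := D.h_bdd.mono_exponent le_top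
  have hg : MemLp (f + α • D.h) 2 (volume.restrict D.Ω) := hf.add (hh.const_smul α)
  obtain ⟨x, hx, rfl, hxe⟩ := (isInvLaplacian_iff hg).1 hq
  refine reduces_of_isSolution hf ((isSolution_iff hf).2 ⟨fun _ => D.const α,
    fun z => (α * z) • D.one + x, fun z => ?_, fun z _ => ?_, continuousOn_const, ?_, fun z _ => ?_,
    fun v hv z _ => ?_⟩)
  · rw [const_eq_smul]; rfl
  · simp_rw [const_eq_smul (α * _)]
    rw [const_eq_smul α]
    have h1 : HasDerivWithinAt (fun z : ℝ => α * z) α I z := by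
      simpa using (hasDerivWithinAt_id z I).const_mul α
    exact (h1.smul_const (D.const 1)).add_const x.1
  · have : (fun z : ℝ => ((α * z) • D.one + x).2.1) = fun _ => x.2.1 := by
      funext z; simp [one]
    rw [this]; exact continuousOn_const
  · exact add_mem (Submodule.smul_mem _ _ (one_mem_V hc)) hx
  · have hmul : mulL2 D.h_bdd (D.const α) = α • hh.toLp D.h := by
      refine Lp.ext ?_
      filter_upwards [coeFn_mulL2 D.h_bdd (D.const α), coeFn_const (D := D) α,
        Lp.coeFn_smul α (hh.toLp D.h), hh.coeFn_toLp] with y h1 h2 h3 h4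
      rw [h1, h2, h3, Pi.smul_apply, h4, smul_eq_mul, smul_eq_mul, mul_comm]
    refine (hasDerivWithinAt_const z I (inner ℝ (mulL2 D.c_bdd (D.const α)) v.1)).congr_deriv ?_
    rw [energy_add_left, energy_smul_left, energy_one_of_not_controlled hc, hxe v hv,
      MemLp.toLp_add hf (hh.const_smul α), MemLp.toLp_const_smul α hh, hmul, inner_add_left]
    ring

theorem coeFn_mulL2_mul {a : Plane → ℝ} (ha : MemLp a ⊤ (volume.restrict D.Ω)) (s : D.L2) :
    mulL2 ha s =ᵐ[volume.restrict D.Ω] fun x => a x * s x := coeFn_mulL2 ha s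

theorem memLp_mul {a : Plane → ℝ} (ha : MemLp a ⊤ (volume.restrict D.Ω)) (s : D.L2) :
    MemLp (fun x => a x * s x) 2 (volume.restrict D.Ω) :=
  (Lp.memLp (mulL2 ha s)).ae_eq (coeFn_mulL2_mul ha s)

theorem memLp_c : MemLp D.c 2 (volume.restrict D.Ω) := D.c_bdd.mono_exponent le_top

theorem memLp_h : MemLp D.h 2 (volume.restrict D.Ω) := D.h_bdd.mono_exponent le_top

theorem mulL2_const {a : Plane → ℝ} (ha : MemLp a ⊤ (volume.restrict D.Ω))
    (ha' : MemLp a 2 (volume.restrict D.Ω)) : mulL2 ha (D.const 1) = ha'.toLp a := by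
  refine Lp.ext ?_
  filter_upwards [coeFn_mulL2_mul ha (D.const 1), coeFn_const (D := D) 1, ha'.coeFn_toLp]
    with y h1 h2 h3
  rw [h1, h2, h3, mul_one]

/-- The weak equation of `w` tested with `w`: no boundary term survives, so `∫ σ |∇w|² = -∫ h w`. -/
theorem integral_c_sub_mul (hc : ¬ D.ConstantsControlled) {w : D.L2} (hw : D.IsInvLaplacian D.h w)
    {G : Plane → Plane} (hG : IsWeakGradient D.Ω w G) :
    ∫ x in D.Ω, (D.c x - D.h x * w x) =
      (∫ x in D.Ω, D.c x) + ∫ x in D.Ω, D.σ x * ‖G x‖ ^ 2 := by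
  obtain ⟨x, hx, rfl, hxe⟩ := (isInvLaplacian_iff memLp_h).1 hw
  have h1 := hxe x hx
  rw [energy_eq_of_not_controlled hc, inner_mulL2, inner_toLp] at h1
  have h2 := (isWeakGradient_of_mem_closure hx.1).ae_eq D.isOpen hG
  have h3 : ∫ y in D.Ω, D.σ y * inner ℝ (x.2.1 y) (x.2.1 y) = ∫ y in D.Ω, D.σ y * ‖G y‖ ^ 2 := by
    refine integral_congr_ae ?_
    filter_upwards [h2] with y hy
    rw [hy, real_inner_self_eq_norm_sq]
  rw [integral_sub (memLp_c.integrable one_le_two) ((memLp_mul D.h_bdd x.1).integrable one_le_two),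
    ← h3, h1]
  ring

theorem integral_c_sub_mul_pos (hc : ¬ D.ConstantsControlled) {w : D.L2}
    (hw : D.IsInvLaplacian D.h w) : 0 < ∫ x in D.Ω, (D.c x - D.h x * w x) := by
  obtain ⟨G, g, hadm, -⟩ := id hw
  rw [integral_c_sub_mul hc hw hadm.grad]
  obtain ⟨m, hm, hcm⟩ := D.c_pos
  obtain ⟨m', hm', hσ⟩ := D.σ_pos
  have h1 : m * volume.real D.Ω ≤ ∫ x in D.Ω, D.c x := by
    have := integral_mono_ae (integrable_const m) (memLp_c.integrable one_le_two) hcm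
    simpa [mul_comm] using this
  have h2 : 0 ≤ ∫ x in D.Ω, D.σ x * ‖G x‖ ^ 2 := by
    refine integral_nonneg_of_ae ?_
    filter_upwards [hσ] with x hx
    exact mul_nonneg (hm'.le.trans hx) (sq_nonneg _)
  have h3 := mul_pos hm (volume_real_pos (D := D))
  linarith

/-- The energy of `α z w` yields `-α z h`, which cancels the linear part of `h ∂_z T̃`. What remains
of that term, `α h w`, and the term `α c` from `c ∂_zz T̃` are compensated by the source of `q`. -/
theorem reduces_of_balanced (hc : ¬ D.ConstantsControlled) (I : Set ℝ) {f : Plane → ℝ}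
    (hf : MemLp f 2 (volume.restrict D.Ω)) {α : ℝ} {w q : D.L2} (hw : D.IsInvLaplacian D.h w)
    (hq : D.IsInvLaplacian (fun x => f x - α * (D.c x - D.h x * w x)) q) :
    D.Reduces I f (fun z => α • (D.const (z ^ 2 / 2) + z • w) + q) := by
  obtain ⟨y, hy, rfl, hye⟩ := (isInvLaplacian_iff memLp_h).1 hw
  have hhw := memLp_mul D.h_bdd y.1
  have hg : MemLp (f - α • (D.c - fun x => D.h x * y.1 x)) 2 (volume.restrict D.Ω) :=
    hf.sub ((memLp_c.sub hhw).const_smul α)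
  obtain ⟨x, hx, rfl, hxe⟩ := (isInvLaplacian_iff hg).1 hq
  have hsq : ∀ z : ℝ, HasDerivWithinAt (fun z : ℝ => z ^ 2 / 2) z I z := fun z => by
    have := ((hasDerivWithinAt_id z I).pow 2).div_const 2
    simpa using this
  refine reduces_of_isSolution hf ((isSolution_iff hf).2 ⟨fun z => α • (z • D.const 1 + y.1),
    fun z => α • ((z ^ 2 / 2) • D.one + z • y) + x, fun z => ?_, fun z _ => ?_, ?_, ?_, fun z _ => ?_,
    fun v hv z _ => ?_⟩)
  · rw [const_eq_smul]; rfl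
  · simp_rw [const_eq_smul (_ ^ 2 / 2)]
    have h2 : HasDerivWithinAt (fun z : ℝ => z • y.1) y.1 I z := by
      simpa using (hasDerivWithinAt_id z I).smul_const y.1
    exact ((((hsq z).smul_const (D.const 1)).add h2).const_smul α).add_const x.1
  · exact Continuous.continuousOn (by fun_prop)
  · have : (fun z : ℝ => (α • ((z ^ 2 / 2) • D.one + z • y) + x).2.1) =
        fun z => α • (z • y.2.1) + x.2.1 := by
      funext z; simp [one]
    rw [this]; exact Continuous.continuousOn (by fun_prop)
  · exact add_mem (Submodule.smul_mem _ _ (add_mem (Submodule.smul_mem _ _ (one_mem_V hc))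
      (Submodule.smul_mem _ _ hy))) hx
  · have hγ : hg.toLp _ = hf.toLp f - α • (memLp_c.toLp D.c - mulL2 D.h_bdd y.1) := by
      rw [MemLp.toLp_sub hf ((memLp_c.sub hhw).const_smul α),
        MemLp.toLp_const_smul α (memLp_c.sub hhw), MemLp.toLp_sub memLp_c hhw]
      congr 3
      exact Lp.ext (hhw.coeFn_toLp.trans (coeFn_mulL2_mul D.h_bdd y.1).symm)
    have hderiv : HasDerivWithinAt
        (fun t : ℝ => α * (t * inner ℝ (memLp_c.toLp D.c) v.1 + inner ℝ (mulL2 D.c_bdd y.1) v.1))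
        (α * inner ℝ (memLp_c.toLp D.c) v.1) I z := by
      simpa using ((((hasDerivWithinAt_id z I).mul_const
        (inner ℝ (memLp_c.toLp D.c) v.1)).add_const
          (inner ℝ (mulL2 D.c_bdd y.1) v.1)).const_mul α)
    have hfun : ∀ t : ℝ, inner ℝ (mulL2 D.c_bdd (α • (t • D.const 1 + y.1))) v.1 =
        α * (t * inner ℝ (memLp_c.toLp D.c) v.1 + inner ℝ (mulL2 D.c_bdd y.1) v.1) := fun t => by
      rw [map_smul, map_add, map_smul, mulL2_const D.c_bdd memLp_c, real_inner_smul_left,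
        inner_add_left, real_inner_smul_left]
    simp_rw [hfun]
    refine hderiv.congr_deriv ?_
    rw [energy_add_left, energy_smul_left, energy_add_left, energy_smul_left, energy_smul_left,
      energy_one_of_not_controlled hc, hye v hv, hxe v hv, hγ]
    simp only [map_add, map_smul, mulL2_const D.h_bdd memLp_h, inner_sub_left, inner_add_left,
      real_inner_smul_left]
    ring

end Setting
end Graetz
end

/-! ### The reduction in the three cases -/

theorem mainTheorem8 (D : Graetz.Setting) (gradh : Graetz.Plane → Graetz.Plane)
    (hgrad : Graetz.IsWeakGradient D.Ω D.h gradh) (μ f : Graetz.Plane → ℝ)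
    (hf : f = Graetz.viscousSource μ gradh)
    (hfL2 : MemLp f 2 (volume.restrict D.Ω))
    (I : Set ℝ) (hI : I.OrdConnected) (hI' : I.Nontrivial) :
    -- the constants are controlled
    (D.ConstantsControlled →
      (∃! q : D.L2, D.IsInvLaplacian f q) ∧
      ∀ q : D.L2, D.IsInvLaplacian f q → D.Reduces I f (fun _ => q)) ∧
    -- the constants are not controlled, non-balanced case
    (¬ D.ConstantsControlled → (∫ x in D.Ω, D.h x) ≠ 0 →
      (∃! α : ℝ, ∫ x in D.Ω, (f x + α * D.h x) = 0) ∧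
      ∀ α : ℝ, ∫ x in D.Ω, (f x + α * D.h x) = 0 →
        D.InvLaplacianModConst (fun x => f x + α * D.h x) ∧
        ∀ q : D.L2, D.IsInvLaplacian (fun x => f x + α * D.h x) q →
          D.Reduces I f (fun z => D.const (α * z) + q)) ∧
    -- the constants are not controlled, balanced case
    (¬ D.ConstantsControlled → (∫ x in D.Ω, D.h x) = 0 →
      D.InvLaplacianModConst D.h ∧
      ∀ w : D.L2, D.IsInvLaplacian D.h w →
        (∀ Gw : Graetz.Plane → Graetz.Plane, Graetz.IsWeakGradient D.Ω w Gw →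
          ∫ x in D.Ω, (D.c x - D.h x * w x) =
            (∫ x in D.Ω, D.c x) + ∫ x in D.Ω, D.σ x * ‖Gw x‖ ^ 2) ∧
        0 < ∫ x in D.Ω, (D.c x - D.h x * w x) ∧
        (∃! α : ℝ, α * ∫ x in D.Ω, (D.c x - D.h x * w x) = ∫ x in D.Ω, f x) ∧
        ∀ (α : ℝ) (γ : Graetz.Plane → ℝ),
          α * ∫ x in D.Ω, (D.c x - D.h x * w x) = ∫ x in D.Ω, f x →
          (γ = fun x => f x - α * (D.c x - D.h x * w x)) →
          MemLp γ 2 (volume.restrict D.Ω) ∧ ∫ x in D.Ω, γ x = 0 ∧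
          D.InvLaplacianModConst γ ∧
          ∀ q : D.L2, D.IsInvLaplacian γ q →
            D.Reduces I f (fun z => α • (D.const (z ^ 2 / 2) + z • w) + q)) := by
  refine ⟨fun hc => ⟨Graetz.Setting.existsUnique_isInvLaplacian hc hfL2, fun q hq =>
    Graetz.Setting.reduces_of_isInvLaplacian I hfL2 hq⟩, fun hc hne => ?_, fun hc h0 => ?_⟩
  · have hh := (Graetz.Setting.memLp_h (D := D)).integrable one_le_two
    have hint : ∀ α : ℝ, ∫ x in D.Ω, (f x + α * D.h x) =
        (∫ x in D.Ω, f x) + α * ∫ x in D.Ω, D.h x := fun α => by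
      rw [integral_add (hfL2.integrable one_le_two) (hh.const_mul α), integral_const_mul]
    refine ⟨⟨-(∫ x in D.Ω, f x) / ∫ x in D.Ω, D.h x, ?_, fun α hα => ?_⟩, fun α hα => ⟨?_, ?_⟩⟩
    · simp only [hint]
      field_simp
      ring
    · simp only [hint] at hα
      rw [eq_div_iff hne]
      linarith
    · exact Graetz.Setting.invLaplacianModConst hc
        (hfL2.add (Graetz.Setting.memLp_h.const_smul α)) hα
    · exact fun q hq => Graetz.Setting.reduces_of_not_balanced hc I hfL2 hq
  · refine ⟨Graetz.Setting.invLaplacianModConst hc Graetz.Setting.memLp_h h0, fun w hw => ?_⟩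
    have hpos := Graetz.Setting.integral_c_sub_mul_pos hc hw
    refine ⟨fun Gw hGw => Graetz.Setting.integral_c_sub_mul hc hw hGw, hpos,
      ⟨(∫ x in D.Ω, f x) / ∫ x in D.Ω, (D.c x - D.h x * w x), div_mul_cancel₀ _ hpos.ne',
        fun α hα => eq_div_of_mul_eq hpos.ne' hα⟩, ?_⟩
    rintro α γ hα rfl
    have hcw : MemLp (fun x => D.c x - D.h x * w x) 2 (volume.restrict D.Ω) :=
      Graetz.Setting.memLp_c.sub (Graetz.Setting.memLp_mul D.h_bdd w)
    have hγ : MemLp (fun x => f x - α * (D.c x - D.h x * w x)) 2 (volume.restrict D.Ω) :=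
      hfL2.sub (hcw.const_mul α)
    have hγ0 : ∫ x in D.Ω, (f x - α * (D.c x - D.h x * w x)) = 0 := by
      rw [integral_sub (hfL2.integrable one_le_two) ((hcw.integrable one_le_two).const_mul α),
        integral_const_mul, hα, sub_self]
    exact ⟨hγ, hγ0, Graetz.Setting.invLaplacianModConst hc hγ hγ0,
      fun q hq => Graetz.Setting.reduces_of_balanced hc I hfL2 hw hq⟩
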